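/- Let $\Gamma$ be an infinite group given by a finite presentation with finite generating set $S\subset\Gamma$, and let $D\in\mathbb N$ be at least the length of every defining relator. Let $\mathrm{Cay}(\Gamma,S)$ be the oriented Cayley graph with vertex set $V=\Gamma$ and edge set $E=\Gamma\times S$, where $(g,s)$ goes from $g$ to $gs$. Let $\mathrm{Cay}^{(2)}(\Gamma,S)$ be the $2$-complex obtained by gluing one polygon, with an arbitrarily chosen orientation, to each simple cycle of length at most $D$ in the underlying non-oriented (multi)graph; let $F$ be the set of these polygons. Let $d$ and $\partial$ be the cellular coboundary and boundary operators between the real Hilbert spaces $\ell^2(V),\ell^2(E),\ell^2(F)$ (these operators are bounded), let $$\Delta_1=\partial d+d\partial\colon \ell^2(E)\to\ell^2(E)$$ be the Hodge Laplacian on $1$-cochains, and let $$\ell^2_{0,c}(E)=\operatorname{clos}_{\ell^2(E)}\{f\colon E\to\mathbb R \mid \partial f=0,\ \operatorname{supp} f \text{ finite}\},$$ which is invariant under $\Delta_1$. If $\Delta_1$ has a spectral gap on $\ell^2_{0,c}(E)$, that is, if $$\operatorname{spec}\bigl(\Delta_1|_{\ell^2_{0,c}(E)}\bigr)\cap[0,\varepsilon)=\varnothing\quad\text{for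 some }\varepsilon>0,$$ then $\Gamma$ has exponential growth (there is $c>1$ such that, for every $n$, the ball of radius $n$ around $1$ in the word metric of $S$ has at least $c^n$ elements) or $\Gamma$ is virtually infinite cyclic (it has an infinite cyclic subgroup of finite index). -/

import Mathlib

noncomputable section

namespace CoexactGap

/-! ### Operators given by locally finite incidence numbers -/

/-- The Hilbert space `ℓ²(ι)` of real square summable functions. -/
abbrev L2 (ι : Type*) : Type _ := lp (fun _ : ι => ℝ) 2

/-- Incidence numbers are uniformly bounded, and every row and every column has a uniformly
bounded number of non-zero entries. -/
def BoundedIncidence {J I : Type*} (A : J → I → ℝ) : Prop :=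
  ∃ M : ℕ, (∀ j i, |A j i| ≤ M) ∧
    (∀ j, ∃ t : Finset I, t.card ≤ M ∧ ∀ i, A j i ≠ 0 → i ∈ t) ∧
    (∀ i, ∃ t : Finset J, t.card ≤ M ∧ ∀ j, A j i ≠ 0 → j ∈ t)

theorem BoundedIncidence.transpose {J I : Type*} {A : J → I → ℝ} (hA : BoundedIncidence A) :
    BoundedIncidence (fun i j => A j i) := by
  obtain ⟨M, h1, h2, h3⟩ := hA
  exact ⟨M, fun i j => h1 j i, h3, h2⟩

/-- The action of incidence numbers on arbitrary cochains: `(A f)(j) = ∑ᵢ A(j,i) f(i)`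
(the sum is finite when rows are finitely supported). -/
def incMap {J I : Type*} (A : J → I → ℝ) (f : I → ℝ) : J → ℝ :=
  fun j => ∑ᶠ i, A j i * f i

theorem incMap_eq_sum {J I : Type*} (A : J → I → ℝ) (f : I → ℝ) (j : J) (t : Finset I)
    (ht : ∀ i, A j i ≠ 0 → i ∈ t) : incMap A f j = ∑ i ∈ t, A j i * f i := by
  unfold incMap
  apply finsum_eq_sum_of_support_subset
  intro i hi
  exact ht i (left_ne_zero_of_mul hi)

theorem BoundedIncidence.exists_sum_bound {J I : Type*} {A : J → I → ℝ}
    (hA : BoundedIncidence A) :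
    ∃ C : ℝ, 0 ≤ C ∧ ∀ (f : L2 I) (s : Finset J),
      ∑ j ∈ s, (incMap A f j) ^ 2 ≤ (C * ‖f‖) ^ 2 := by
  classical
  obtain ⟨M, h1, h2, h3⟩ := hA
  refine ⟨(M : ℝ) ^ 2, by positivity, fun f s => ?_⟩
  choose t ht htA using h2
  choose t' ht' htA' using h3
  have hrow : ∀ j, (incMap A f j) ^ 2 ≤ (M : ℝ) ^ 3 * ∑ i ∈ (t j).filter (fun i => A j i ≠ 0),
      (f i) ^ 2 := by
    intro j
    have hA0 : ∀ i, A j i ≠ 0 → i ∈ (t j).filter (fun i => A j i ≠ 0) := fun i hi =>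
      Finset.mem_filter.2 ⟨htA j i hi, hi⟩
    rw [incMap_eq_sum A f j _ hA0]
    have hc : (((t j).filter (fun i => A j i ≠ 0)).card : ℝ) ≤ M := by
      exact_mod_cast (Finset.card_filter_le _ _).trans (ht j)
    calc _ ≤ (((t j).filter (fun i => A j i ≠ 0)).card : ℝ) *
          ∑ i ∈ (t j).filter (fun i => A j i ≠ 0), (A j i * f i) ^ 2 := sq_sum_le_card_mul_sum_sq
      _ ≤ (M : ℝ) * ∑ i ∈ (t j).filter (fun i => A j i ≠ 0), (M : ℝ) ^ 2 * (f i) ^ 2 := by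
          apply mul_le_mul hc _ (Finset.sum_nonneg fun i _ => sq_nonneg _) (by positivity)
          apply Finset.sum_le_sum
          intro i _
          rw [mul_pow]
          apply mul_le_mul_of_nonneg_right _ (sq_nonneg _)
          exact sq_le_sq.2 (by simpa using h1 j i)
      _ = _ := by rw [← Finset.mul_sum]; ring
  set T := s.biUnion t with hT
  have hf : ∑ i ∈ T, (f i) ^ 2 ≤ ‖f‖ ^ 2 := by
    have := lp.sum_rpow_le_norm_rpow (p := 2) (by norm_num) f T
    simpa using this
  calc ∑ j ∈ s, (incMap A f j) ^ 2
      ≤ ∑ j ∈ s, (M : ℝ) ^ 3 * ∑ i ∈ (t j).filter (fun i => A j i ≠ 0), (f i) ^ 2 :=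
        Finset.sum_le_sum fun j _ => hrow j
    _ ≤ ∑ j ∈ s, (M : ℝ) ^ 3 * ∑ i ∈ T, if A j i ≠ 0 then (f i) ^ 2 else 0 := by
        apply Finset.sum_le_sum
        intro j hj
        apply mul_le_mul_of_nonneg_left _ (by positivity)
        rw [← Finset.sum_filter]
        apply Finset.sum_le_sum_of_subset_of_nonneg
        · exact Finset.filter_subset_filter _ (Finset.subset_biUnion_of_mem t hj)
        · intros; positivity
    _ = (M : ℝ) ^ 3 * ∑ i ∈ T, ∑ j ∈ s, if A j i ≠ 0 then (f i) ^ 2 else 0 := by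
        rw [← Finset.mul_sum, Finset.sum_comm]
    _ ≤ (M : ℝ) ^ 3 * ∑ i ∈ T, (M : ℝ) * (f i) ^ 2 := by
        apply mul_le_mul_of_nonneg_left _ (by positivity)
        apply Finset.sum_le_sum
        intro i _
        rw [← Finset.sum_filter, Finset.sum_const, nsmul_eq_mul]
        apply mul_le_mul_of_nonneg_right _ (sq_nonneg _)
        have : (s.filter (fun j => A j i ≠ 0)).card ≤ (t' i).card :=
          Finset.card_le_card fun j hj => htA' i j (Finset.mem_filter.1 hj).2
        exact_mod_cast this.trans (ht' i)
    _ ≤ (M : ℝ) ^ 4 * ‖f‖ ^ 2 := by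
        rw [← Finset.mul_sum, ← mul_assoc, ← pow_succ]
        exact mul_le_mul_of_nonneg_left hf (by positivity)
    _ = ((M : ℝ) ^ 2 * ‖f‖) ^ 2 := by ring

theorem BoundedIncidence.memℓp {J I : Type*} {A : J → I → ℝ} (hA : BoundedIncidence A)
    (f : L2 I) : Memℓp (incMap A f) 2 := by
  obtain ⟨C, _, h⟩ := hA.exists_sum_bound
  apply memℓp_gen' (C := (C * ‖f‖) ^ 2)
  intro s
  simpa using h f s

/-- The bounded operator `ℓ²(I) → ℓ²(J)` given by bounded incidence numbers. -/
def incCLM {J I : Type*} (A : J → I → ℝ) (hA : BoundedIncidence A) : L2 I →L[ℝ] L2 J :=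
  LinearMap.mkContinuousOfExistsBound
    { toFun := fun f => ⟨incMap A f, hA.memℓp f⟩
      map_add' := by
        intro f g
        obtain ⟨M, -, h2, -⟩ := hA
        ext j
        obtain ⟨t, -, ht⟩ := h2 j
        change incMap A _ j = incMap A _ j + incMap A _ j
        rw [incMap_eq_sum _ _ _ t ht, incMap_eq_sum _ _ _ t ht, incMap_eq_sum _ _ _ t ht,
          ← Finset.sum_add_distrib]
        exact Finset.sum_congr rfl fun i _ => mul_add _ _ _
      map_smul' := by
        intro c f
        obtain ⟨M, -, h2, -⟩ := hA
        ext j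
        obtain ⟨t, -, ht⟩ := h2 j
        change incMap A _ j = c * incMap A _ j
        rw [incMap_eq_sum _ _ _ t ht, incMap_eq_sum _ _ _ t ht, Finset.mul_sum]
        exact Finset.sum_congr rfl fun i _ => mul_left_comm _ _ _ }
    (by
      obtain ⟨C, hC, h⟩ := hA.exists_sum_bound
      refine ⟨C, fun f => ?_⟩
      apply lp.norm_le_of_forall_sum_le (p := 2) (by norm_num) (by positivity)
      intro s
      simpa using h f s)

theorem incCLM_apply {J I : Type*} (A : J → I → ℝ) (hA : BoundedIncidence A) (f : L2 I) (j : J) :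
    incCLM A hA f j = ∑ᶠ i, A j i * f i := rfl

/-! ### Oriented graphs, cycles and faces -/

/-- An oriented graph (loops and multiple edges allowed). -/
structure OrientedGraph (V E : Type*) where
  /-- beginning of an edge -/
  beg : E → V
  /-- end of an edge -/
  ennd : E → V

namespace OrientedGraph

variable {V E : Type*} (G : OrientedGraph V E)

/-- Starting vertex of an edge passed in its direction (`true`) or in the reversed one (`false`). -/
def src (a : E × Bool) : V := if a.2 then G.beg a.1 else G.ennd a.1

/-- Final vertex of an edge passed in its direction (`true`) or in the reversed one (`false`). -/
def tgt (a : E × Bool) : V := if a.2 then G.ennd a.1 else G.beg a.1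

/-- A simple cycle of positive length in the underlying non-oriented graph, with a direction and a
starting point: neither vertices nor edges are repeated. -/
structure Cycle where
  /-- number of edges -/
  len : ℕ
  len_pos : NeZero len
  /-- the edges in cyclic order, with the direction in which they are passed -/
  step : ZMod len → E × Bool
  closed : ∀ i, G.tgt (step i) = G.src (step (i + 1))
  vertex_injective : Function.Injective fun i => G.src (step i)
  edge_injective : Function.Injective fun i => (step i).1

variable {G}

/-- The set of edges of a cycle. -/
def Cycle.edgeSet (γ : G.Cycle) : Set E := Set.range fun i => (γ.step i).1

open Classical in
/-- The `1`-chain of a cycle: the number of passes through `e` in its direction minus the number of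
passes in the reversed direction. -/
def Cycle.chain (γ : G.Cycle) (e : E) : ℝ :=
  haveI := γ.len_pos
  ∑ i : ZMod γ.len, if (γ.step i).1 = e then (if (γ.step i).2 then 1 else -1) else 0

variable (G)

/-- The faces of `G⁽²⁾`: one polygon for every non-oriented simple cycle of length at most `D`.
Such a cycle is recorded by its set of edges, which determines it. -/
def Face (D : ℕ) : Type _ := {σ : Set E // ∃ γ : G.Cycle, γ.len ≤ D ∧ γ.edgeSet = σ}

/-- A choice of orientation for every face: a cycle running once around its boundary. -/
def FaceOrientation (D : ℕ) : Type _ :=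
  (σ : G.Face D) → {γ : G.Cycle // γ.len ≤ D ∧ γ.edgeSet = σ.1}

open Classical in
/-- Incidence number of an edge and a vertex: `+1` at the end, `-1` at the beginning. -/
def inc₁ (e : E) (v : V) : ℝ :=
  (if G.ennd e = v then 1 else 0) - (if G.beg e = v then 1 else 0)

variable {G}

/-- Incidence number of an oriented face and an edge. -/
def inc₂ {D : ℕ} (o : G.FaceOrientation D) (σ : G.Face D) (e : E) : ℝ := (o σ).1.chain e

theorem Cycle.chain_eq_zero (γ : G.Cycle) {e : E} (he : e ∉ γ.edgeSet) : γ.chain e = 0 := by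
  unfold Cycle.chain
  apply Finset.sum_eq_zero
  intro i _
  rw [if_neg]
  rintro rfl
  exact he ⟨i, rfl⟩

theorem Cycle.abs_chain_le (γ : G.Cycle) (e : E) : |γ.chain e| ≤ γ.len := by
  unfold Cycle.chain
  have := γ.len_pos
  refine (Finset.abs_sum_le_sum_abs _ _).trans ?_
  refine (Finset.sum_le_card_nsmul _ _ 1 ?_).trans ?_
  · intro i _
    split_ifs <;> simp
  · simp [ZMod.card]

/-- The boundary of the chain of a cycle vanishes. -/
theorem Cycle.sum_chain_mul_inc₁ (γ : G.Cycle) (v : V) (t : Finset E)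
    (ht : γ.edgeSet ⊆ t) : ∑ e ∈ t, γ.chain e * G.inc₁ e v = 0 := by
  classical
  have := γ.len_pos
  have h1 : ∑ e ∈ t, γ.chain e * G.inc₁ e v =
      ∑ i : ZMod γ.len, (if (γ.step i).2 then 1 else -1) * G.inc₁ (γ.step i).1 v := by
    unfold Cycle.chain
    simp_rw [Finset.sum_mul]
    rw [Finset.sum_comm]
    apply Finset.sum_congr rfl
    intro i _
    rw [Finset.sum_eq_single (γ.step i).1]
    · simp
    · intro b _ hb
      rw [if_neg (Ne.symm hb), zero_mul]
    · intro h
      exact absurd (ht ⟨i, rfl⟩) h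
  have h2 : ∀ i, (if (γ.step i).2 then (1 : ℝ) else -1) * G.inc₁ (γ.step i).1 v =
      (if G.src (γ.step (i + 1)) = v then 1 else 0) - (if G.src (γ.step i) = v then 1 else 0) := by
    intro i
    rw [← γ.closed i]
    unfold inc₁ src tgt
    cases (γ.step i).2 <;> simp
  rw [h1, Finset.sum_congr rfl fun i _ => h2 i, Finset.sum_sub_distrib, sub_eq_zero]
  exact Fintype.sum_equiv (Equiv.addRight 1) _ _ fun i => rfl

end OrientedGraph

/-! ### Cayley graphs -/

section Cayley

variable {Γ : Type*} [Group Γ] (S : Finset Γ)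

/-- The Cayley graph of `Γ` with respect to `S`: an edge from `g` to `g * s` for all `g ∈ Γ` and
`s ∈ S`. -/
def cayley : OrientedGraph Γ (Γ × S) where
  beg e := e.1
  ennd e := e.1 * e.2

open scoped Pointwise in
theorem cayley_face_near (D : ℕ) : ∃ B : Set Γ, B.Finite ∧ ∀ γ : (cayley S).Cycle, γ.len ≤ D →
    ∀ e ∈ γ.edgeSet, ∀ e' ∈ γ.edgeSet, e.1⁻¹ * e'.1 ∈ B := by
  classical
  set U : Finset Γ := insert 1 (S ∪ S⁻¹) with hU
  have h1U : (1 : Γ) ∈ U := Finset.mem_insert_self _ _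
  have hUinv : ∀ {x}, x ∈ U → x⁻¹ ∈ U := by
    intro x hx
    simp only [hU, Finset.mem_insert, Finset.mem_union, Finset.mem_inv'] at hx ⊢
    rcases hx with rfl | h | h
    · simp
    · right; right; simpa using h
    · right; left; exact h
  refine ⟨↑(U * U ^ D * U), Finset.finite_toSet _, fun γ hγ => ?_⟩
  have := γ.len_pos
  have hstep : ∀ i, ((cayley S).src (γ.step i))⁻¹ * (cayley S).tgt (γ.step i) ∈ U := by
    intro i
    have hs : ((γ.step i).1.2 : Γ) ∈ U :=
      Finset.mem_insert_of_mem (Finset.mem_union_left _ (γ.step i).1.2.2)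
    unfold OrientedGraph.src OrientedGraph.tgt cayley
    cases (γ.step i).2
    · simpa [mul_assoc] using hUinv hs
    · simpa using hs
  have hwalk : ∀ (i : ZMod γ.len) (k : ℕ),
      ((cayley S).src (γ.step i))⁻¹ * (cayley S).src (γ.step (i + k)) ∈ U ^ k := by
    intro i k
    induction k with
    | zero => simp
    | succ k ih =>
      have h := hstep (i + k)
      rw [γ.closed] at h
      rw [pow_succ]
      have := Finset.mul_mem_mul ih h
      simpa [mul_assoc, add_assoc] using this
  have hbeg : ∀ i, ((cayley S).src (γ.step i))⁻¹ * (γ.step i).1.1 ∈ U := by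
    intro i
    have h := hstep i
    revert h
    unfold OrientedGraph.src OrientedGraph.tgt cayley
    cases (γ.step i).2
    · simp
    · simp [h1U]
  rintro _ ⟨i, rfl⟩ _ ⟨j, rfl⟩
  have h1 := hUinv (hbeg i)
  have h2 := hwalk i (j - i).val
  have h3 := hbeg j
  have hle : (j - i).val ≤ D := (ZMod.val_lt _).le.trans hγ
  have h2' := Finset.pow_subset_pow_right h1U hle h2
  have h4 := Finset.mul_mem_mul (Finset.mul_mem_mul h1 h2') h3
  rw [Finset.mem_coe]
  have hij : i + ((j - i).val : ZMod γ.len) = j := by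
    rw [ZMod.natCast_zmod_val, add_sub_cancel]
  rw [hij] at h4
  convert h4 using 1
  group

theorem cayley_boundedIncidence₁ : BoundedIncidence (cayley S).inc₁ := by
  classical
  refine ⟨2 * S.card + 2, ?_, ?_, ?_⟩
  · intro e v
    unfold OrientedGraph.inc₁
    have : (0 : ℝ) ≤ S.card := by positivity
    push_cast
    split_ifs <;> simp <;> linarith
  · intro e
    refine ⟨{(cayley S).ennd e, (cayley S).beg e}, (Finset.card_le_two).trans (by omega), ?_⟩
    intro v hv
    by_contra h
    simp only [Finset.mem_insert, Finset.mem_singleton, not_or] at h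
    apply hv
    unfold OrientedGraph.inc₁
    rw [if_neg (Ne.symm h.1), if_neg (Ne.symm h.2), sub_zero]
  · intro v
    refine ⟨(Finset.univ : Finset S).image (fun s => (v, s)) ∪
      (Finset.univ : Finset S).image (fun s : S => (v * (s : Γ)⁻¹, s)), ?_, ?_⟩
    · refine (Finset.card_union_le _ _).trans ?_
      have h1 := Finset.card_image_le (s := (Finset.univ : Finset S)) (f := fun s => (v, s))
      have h2 := Finset.card_image_le (s := (Finset.univ : Finset S))
        (f := fun s : S => (v * (s : Γ)⁻¹, s))
      simp only [Finset.card_univ, Fintype.card_coe] at h1 h2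
      omega
    · rintro ⟨g, s⟩ hv
      by_contra h
      simp only [Finset.mem_union, Finset.mem_image, Finset.mem_univ, true_and, not_or,
        not_exists, Prod.mk.injEq, not_and] at h
      apply hv
      unfold OrientedGraph.inc₁
      rw [if_neg, if_neg, sub_zero]
      · exact fun h' => h.1 s h'.symm rfl
      · rintro rfl
        exact h.2 s (by simp [cayley]) rfl

theorem cayley_boundedIncidence₂ {D : ℕ} (o : (cayley S).FaceOrientation D) :
    BoundedIncidence (OrientedGraph.inc₂ o) := by
  classical
  obtain ⟨B, hB, h⟩ := cayley_face_near S D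
  have hfin : ∀ e : Γ × S, ∃ N : Finset (Γ × S), N.card ≤ hB.toFinset.card * S.card ∧
      ∀ σ : (cayley S).Face D, e ∈ σ.1 → σ.1 ⊆ N := by
    intro e
    refine ⟨(hB.toFinset.image fun b => e.1 * b) ×ˢ (Finset.univ : Finset S), ?_, ?_⟩
    · rw [Finset.card_product, Finset.card_univ, Fintype.card_coe]
      exact Nat.mul_le_mul_right _ Finset.card_image_le
    · rintro ⟨_, γ, hγ, rfl⟩ he e' he'
      have := h γ hγ e he e' he'
      simp only [Finset.coe_product, Finset.coe_image, Set.mem_prod, Set.mem_image]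
      exact ⟨⟨_, by simpa using this, by simp⟩, by simp⟩
  have hmem : ∀ σ e, OrientedGraph.inc₂ o σ e ≠ 0 → e ∈ σ.1 := by
    intro σ e hne
    by_contra hn
    apply hne
    apply OrientedGraph.Cycle.chain_eq_zero
    rwa [(o σ).2.2]
  refine ⟨D + 2 ^ (hB.toFinset.card * S.card), ?_, ?_, ?_⟩
  · intro σ e
    refine ((o σ).1.abs_chain_le e).trans ?_
    exact_mod_cast (o σ).2.1.trans (Nat.le_add_right _ _)
  · intro σ
    have := (o σ).1.len_pos
    refine ⟨(Finset.univ : Finset (ZMod (o σ).1.len)).image fun i => ((o σ).1.step i).1, ?_, ?_⟩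
    · refine Finset.card_image_le.trans ?_
      rw [Finset.card_univ, ZMod.card]
      exact (o σ).2.1.trans (Nat.le_add_right _ _)
    · intro e he
      have := hmem σ e he
      rw [← (o σ).2.2] at this
      obtain ⟨i, hi⟩ := this
      exact Finset.mem_image.2 ⟨i, Finset.mem_univ _, hi⟩
  · intro e
    obtain ⟨N, hN, hs⟩ := hfin e
    have hinj : Function.Injective
        (fun σ : {σ : (cayley S).Face D // e ∈ σ.1} => N.filter (fun x => x ∈ σ.1.1)) := by
      intro σ τ hst
      apply Subtype.ext
      apply Subtype.ext
      ext x
      have := congrArg (fun u => x ∈ u) hst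
      simp only [Finset.mem_filter, eq_iff_iff] at this
      constructor
      · intro hx; exact (this.1 ⟨hs _ σ.2 hx, hx⟩).2
      · intro hx; exact (this.2 ⟨hs _ τ.2 hx, hx⟩).2
    have hmaps : Set.MapsTo
        (fun σ : (cayley S).Face D => N.filter (fun x => x ∈ σ.1))
        {σ | e ∈ σ.1} (N.powerset : Set (Finset (Γ × S))) := by
      intro σ _
      exact Finset.mem_coe.2 (Finset.mem_powerset.2 (Finset.filter_subset _ _))
    have hinjOn : Set.InjOn (fun σ : (cayley S).Face D => N.filter (fun x => x ∈ σ.1))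
        {σ | e ∈ σ.1} := by
      intro σ hσ τ hτ hst
      exact congrArg Subtype.val (@hinj ⟨σ, hσ⟩ ⟨τ, hτ⟩ hst)
    have hF : {σ : (cayley S).Face D | e ∈ σ.1}.Finite :=
      Set.Finite.of_injOn hmaps hinjOn (Finset.finite_toSet _)
    refine ⟨hF.toFinset, ?_, fun σ hσ => by simpa using hmem σ e hσ⟩
    have hc : hF.toFinset.card ≤ N.powerset.card := by
      apply Finset.card_le_card_of_injOn (fun σ => N.filter (fun x => x ∈ σ.1))
      · intro σ _
        exact Finset.mem_coe.2 (Finset.mem_powerset.2 (Finset.filter_subset _ _))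
      · intro σ hσ τ hτ hst
        exact hinjOn (by simpa using hσ) (by simpa using hτ) hst
    rw [Finset.card_powerset] at hc
    exact hc.trans ((Nat.pow_le_pow_right (by norm_num) hN).trans (Nat.le_add_left _ _))

/-! ### The complex of cochains and the Hodge Laplacian -/

/-- `d : ℓ²(V) → ℓ²(E)`. -/
def d₀ : L2 Γ →L[ℝ] L2 (Γ × S) := incCLM (cayley S).inc₁ (cayley_boundedIncidence₁ S)

/-- `∂ : ℓ²(E) → ℓ²(V)`. -/
def bd₁ : L2 (Γ × S) →L[ℝ] L2 Γ :=
  incCLM (fun v e => (cayley S).inc₁ e v) (cayley_boundedIncidence₁ S).transpose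

variable {S} {D : ℕ} (o : (cayley S).FaceOrientation D)

/-- `d : ℓ²(E) → ℓ²(F)`. -/
def d₁ : L2 (Γ × S) →L[ℝ] L2 ((cayley S).Face D) :=
  incCLM (OrientedGraph.inc₂ o) (cayley_boundedIncidence₂ S o)

/-- `∂ : ℓ²(F) → ℓ²(E)`. -/
def bd₂ : L2 ((cayley S).Face D) →L[ℝ] L2 (Γ × S) :=
  incCLM (fun e σ => OrientedGraph.inc₂ o σ e) (cayley_boundedIncidence₂ S o).transpose

/-- The Hodge Laplacian `Δ₁ = ∂d + d∂` on `ℓ²(E)`. -/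
def hodgeLaplacian : L2 (Γ × S) →L[ℝ] L2 (Γ × S) := bd₂ o ∘L d₁ o + d₀ S ∘L bd₁ S

variable (S)

/-- Finitely supported `1`-cochains `f` with `∂f = 0`. -/
def finClosed : Submodule ℝ (L2 (Γ × S)) where
  carrier := {f | bd₁ S f = 0 ∧ (Function.support f).Finite}
  add_mem' := by
    rintro f g ⟨hf, hf'⟩ ⟨hg, hg'⟩
    refine ⟨by rw [map_add, hf, hg, add_zero], ?_⟩
    exact (hf'.union hg').subset (Function.support_add _ _)
  zero_mem' := by
    refine ⟨map_zero _, ?_⟩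
    rw [lp.coeFn_zero, Function.support_zero]
    exact Set.finite_empty
  smul_mem' := by
    rintro c f ⟨hf, hf'⟩
    refine ⟨by rw [map_smul, hf, smul_zero], ?_⟩
    exact hf'.subset (Function.support_const_smul_subset c _)

/-- `ℓ²_{0,c}(E)`, the `ℓ²`-closure of the finitely supported closed `1`-cochains. -/
def coexactSpace : Submodule ℝ (L2 (Γ × S)) := (finClosed S).topologicalClosure

variable {S}

theorem finite_support_incCLM {J I : Type*} (A : J → I → ℝ) (hA : BoundedIncidence A) (f : L2 I)
    (hf : (Function.support f).Finite) : (Function.support (incCLM A hA f)).Finite := by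
  classical
  have hA' := hA
  obtain ⟨M, -, -, h3⟩ := hA'
  choose t _ ht using h3
  refine (Finset.finite_toSet (hf.toFinset.biUnion t)).subset ?_
  intro j hj
  by_contra hn
  apply hj
  rw [incCLM_apply]
  apply finsum_eq_zero_of_forall_eq_zero
  intro i
  by_contra hne
  apply hn
  simp only [Finset.coe_biUnion, Set.mem_iUnion]
  exact ⟨i, by simpa using right_ne_zero_of_mul hne, ht i j (left_ne_zero_of_mul hne)⟩

/-- `∂∂ = 0`. -/
theorem bd₁_bd₂ (h : L2 ((cayley S).Face D)) : bd₁ S (bd₂ o h) = 0 := by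
  classical
  obtain ⟨M, -, -, h3⟩ := cayley_boundedIncidence₁ S
  obtain ⟨M', -, -, h3'⟩ := cayley_boundedIncidence₂ S o
  choose t' _ ht' using h3'
  ext v
  obtain ⟨t, -, ht⟩ := h3 v
  change incMap (fun v e => (cayley S).inc₁ e v) (bd₂ o h) v = 0
  set T := t.biUnion t' with hT
  rw [incMap_eq_sum _ _ _ t ht]
  have e1 : ∀ e ∈ t, (cayley S).inc₁ e v * bd₂ o h e =
      ∑ σ ∈ T, (cayley S).inc₁ e v * (OrientedGraph.inc₂ o σ e * h σ) := by
    intro e he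
    rw [← Finset.mul_sum]
    congr 1
    exact incMap_eq_sum (fun e σ => OrientedGraph.inc₂ o σ e) h e T
      fun σ hσ => Finset.mem_biUnion.2 ⟨e, he, ht' e σ hσ⟩
  rw [Finset.sum_congr rfl e1, Finset.sum_comm]
  apply Finset.sum_eq_zero
  intro σ _
  have hfin : (o σ).1.edgeSet.Finite := by
    have := (o σ).1.len_pos
    exact Set.finite_range _
  have key := (o σ).1.sum_chain_mul_inc₁ v (t ∪ hfin.toFinset) (by
    intro e he; simp [he])
  have e2 : ∑ e ∈ t, (o σ).1.chain e * (cayley S).inc₁ e v = 0 := by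
    rw [← key]
    apply Finset.sum_subset Finset.subset_union_left
    intro e _ he
    rw [not_imp_comm.1 (ht e) he, mul_zero]
  calc _ = h σ * ∑ e ∈ t, (o σ).1.chain e * (cayley S).inc₁ e v := by
        rw [Finset.mul_sum]
        apply Finset.sum_congr rfl
        intro e _
        unfold OrientedGraph.inc₂
        ring
    _ = 0 := by rw [e2, mul_zero]

theorem hodgeLaplacian_mem (f : L2 (Γ × S)) (hf : f ∈ coexactSpace S) :
    hodgeLaplacian o f ∈ coexactSpace S := by
  have h0 : Set.MapsTo (hodgeLaplacian o) (finClosed S : Set (L2 (Γ × S))) (finClosed S) := by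
    rintro f ⟨hf, hf'⟩
    have he : hodgeLaplacian o f = bd₂ o (d₁ o f) := by
      simp [hodgeLaplacian, hf]
    rw [he]
    exact ⟨bd₁_bd₂ o _, finite_support_incCLM _ _ _ (finite_support_incCLM _ _ _ hf')⟩
  exact h0.closure (hodgeLaplacian o).continuous hf

/-- The restriction of `Δ₁` to the invariant subspace `ℓ²_{0,c}(E)`. -/
def coexactLaplacian : coexactSpace S →L[ℝ] coexactSpace S :=
  (hodgeLaplacian o ∘L (coexactSpace S).subtypeL).codRestrict (coexactSpace S)
    fun f => hodgeLaplacian_mem o f f.2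

/-- `Δ₁` has a spectral gap on `ℓ²_{0,c}(E)`. -/
def HasCoexactSpectralGap : Prop :=
  ∃ ε : ℝ, 0 < ε ∧ spectrum ℝ (coexactLaplacian o) ∩ Set.Ico 0 ε = ∅

end Cayley

/-! ### Groups -/

/-- `R` is a set of defining relators, written as words in `S` and the formal inverses, for the
group `Γ` generated by `S`. -/
def IsPresentation {Γ : Type*} [Group Γ] (S : Finset Γ) (R : Set (List (S × Bool))) : Prop :=
  Subgroup.closure (S : Set Γ) = ⊤ ∧
    Subgroup.normalClosure (FreeGroup.mk '' R) = (FreeGroup.lift fun s : S => (s : Γ)).ker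

/-- The ball of radius `n` around `1` in the word metric of `S`. -/
def wordBall {Γ : Type*} [Group Γ] (S : Finset Γ) (n : ℕ) : Set Γ :=
  {g | ∃ l : List Γ, l.length ≤ n ∧ (∀ x ∈ l, x ∈ S ∨ x⁻¹ ∈ S) ∧ l.prod = g}

/-- Exponential growth of the group generated by the finite set `S` (for a given group, this does
not depend on the finite generating set). -/
def HasExponentialGrowth {Γ : Type*} [Group Γ] (S : Finset Γ) : Prop :=
  ∃ c : ℝ, 1 < c ∧ ∀ n : ℕ, c ^ n ≤ (wordBall S n).ncard

/-- `Γ` has an infinite cyclic subgroup of finite index. -/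
def IsVirtuallyInfiniteCyclic (Γ : Type*) [Group Γ] : Prop :=
  ∃ H : Subgroup Γ, H.FiniteIndex ∧ IsCyclic H ∧ Infinite H

end CoexactGap

end

namespace CoexactGap

/-! ### Word metric and growth -/

section WordMetric

variable {Γ : Type*} [Group Γ] {S : Finset Γ}

/-! Assume that `Γ` has subexponential growth and is not virtually infinite cyclic. The plan is to
deduce that `d` is bounded below on `ℓ²(V)`, a linear isoperimetric inequality, which makes balls
grow exponentially: a contradiction.

Ends: by a Stallings-type argument with nested translates (`IsCutBy.growth_or_virtually_cyclic`),
every set of vertices with finite coboundary is now finite or cofinite.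

Localization: let `q` be the projection of the delta function of an edge `e` to the orthogonal
complement of `ℓ²_{0,c}(E)`. Then `dq = 0` and `∂q = ∂δ_e`. The gap makes the iterates of `1 - a∂d`
applied to `δ_e` converge to `q` geometrically, and each iteration spreads the support by a bounded
distance, so `q` decays exponentially away from `e` (`exists_exponentially_decaying_projection`).

Potentials: the faces include enough cycles to fill all relators, so `q = du` for some function `u`
(`exists_potential`). Almost all level sets of `u` must be cut by edges far from `e` if they
separate distant points. A coarea estimate, with subexponential growth to sum the tails, therefore
shows that `u` tends exponentially fast to a constant (`exists_const_abs_sub_le`). Subtracting it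
gives `U` in `ℓ²(V)` with `dU = q`.

Conclusion: `(df)(e) = ⟨∂δ_e, f⟩ = ⟨∂dU, f⟩ = ⟨U, ∂df⟩`. The kernel `U` is uniformly exponentially
localized near `e`, so a Schur test bounds `‖df‖` by a multiple of `‖∂df‖` (`exists_norm_d₀_le`). As
`∂ = d*` and `d` is injective, `d` is bounded below. -/

theorem one_mem_wordBall (n : ℕ) : (1 : Γ) ∈ wordBall S n := ⟨[], by simp⟩

theorem wordBall_mono {m n : ℕ} (h : m ≤ n) : wordBall S m ⊆ wordBall S n := by
  rintro g ⟨l, h1, h2, h3⟩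
  exact ⟨l, h1.trans h, h2, h3⟩

theorem mul_mem_wordBall {m n : ℕ} {x y : Γ} (hx : x ∈ wordBall S m) (hy : y ∈ wordBall S n) :
    x * y ∈ wordBall S (m + n) := by
  obtain ⟨l, h1, h2, rfl⟩ := hx
  obtain ⟨l', h1', h2', rfl⟩ := hy
  refine ⟨l ++ l', by simp; omega, ?_, by simp⟩
  intro x hx
  rcases List.mem_append.1 hx with h | h
  exacts [h2 x h, h2' x h]

theorem inv_mem_wordBall {n : ℕ} {x : Γ} (hx : x ∈ wordBall S n) : x⁻¹ ∈ wordBall S n := by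
  obtain ⟨l, h1, h2, rfl⟩ := hx
  refine ⟨(l.map Inv.inv).reverse, by simpa, ?_, by rw [List.prod_inv_reverse]⟩
  intro x hx
  simp only [List.mem_reverse, List.mem_map] at hx
  obtain ⟨y, hy, rfl⟩ := hx
  rw [inv_inv]
  exact (h2 y hy).symm

theorem mem_wordBall_one {s : Γ} (hs : s ∈ S) : s ∈ wordBall S 1 := ⟨[s], by simp [hs]⟩

theorem wordBall_zero : wordBall S 0 = {1} := by
  ext g
  constructor
  · rintro ⟨l, h1, -, rfl⟩
    have : l = [] := List.length_eq_zero_iff.1 (by omega)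
    simp [this]
  · rintro rfl
    exact one_mem_wordBall 0

open scoped Pointwise in
theorem wordBall_add_subset (m n : ℕ) : wordBall S (m + n) ⊆ wordBall S m * wordBall S n := by
  rintro g ⟨l, h1, h2, rfl⟩
  refine ⟨(l.take m).prod, ⟨l.take m, by simp, fun x hx => h2 x (List.mem_of_mem_take hx), rfl⟩,
    (l.drop m).prod, ⟨l.drop m, by simp; omega, fun x hx => h2 x (List.mem_of_mem_drop hx), rfl⟩,
    ?_⟩
  exact List.prod_take_mul_prod_drop l m

theorem finite_wordBall (n : ℕ) : (wordBall S n).Finite := by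
  classical
  induction n with
  | zero => rw [wordBall_zero]; exact Set.finite_singleton _
  | succ n ih =>
    refine (ih.mul (t := wordBall S 1) ?_).subset (wordBall_add_subset n 1)
    refine (Set.finite_singleton (1 : Γ) |>.union (S.finite_toSet.union S.finite_toSet.inv)).subset
      ?_
    rintro g ⟨l, h1, h2, rfl⟩
    match l with
    | [] => simp
    | [x] => simpa using Or.inr (h2 x (by simp))
    | x :: y :: l => simp at h1

theorem ncard_wordBall_add (m n : ℕ) :
    (wordBall S (m + n)).ncard ≤ (wordBall S m).ncard * (wordBall S n).ncard :=
  (Set.ncard_le_ncard (wordBall_add_subset m n)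
    ((finite_wordBall m).mul (finite_wordBall n))).trans Set.natCard_mul_le

theorem ncard_wordBall_mul (m k : ℕ) : (wordBall S (m * k)).ncard ≤ (wordBall S m).ncard ^ k := by
  induction k with
  | zero => simp [wordBall_zero]
  | succ k ih =>
    rw [mul_add, mul_one, pow_succ]
    exact (ncard_wordBall_add _ _).trans (Nat.mul_le_mul_right _ ih)

/-- Failure of exponential growth gives just one radius `m` with `|B(m)| < c ^ m`;
submultiplicativity of ball sizes spreads this to all radii. -/
theorem exists_ncard_wordBall_le (hg : ¬ HasExponentialGrowth S) {c : ℝ} (hc : 1 < c) :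
    ∃ C : ℝ, 0 < C ∧ ∀ n : ℕ, ((wordBall S n).ncard : ℝ) ≤ C * c ^ n := by
  unfold HasExponentialGrowth at hg
  push Not at hg
  obtain ⟨m, hm⟩ := hg c hc
  have hm0 : 0 < m := by
    rcases Nat.eq_zero_or_pos m with rfl | h
    · simp [wordBall_zero] at hm
    · exact h
  have hpos : (0 : ℝ) < (wordBall S m).ncard := by
    exact_mod_cast (Set.ncard_pos (finite_wordBall m)).2 ⟨1, one_mem_wordBall m⟩
  refine ⟨(wordBall S m).ncard, hpos, fun n => ?_⟩
  have h1 : (wordBall S n).ncard ≤ (wordBall S m).ncard ^ (n / m) * (wordBall S m).ncard := by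
    refine (Set.ncard_le_ncard (wordBall_mono (n := m * (n / m) + m) ?_)
      (finite_wordBall _)).trans
      ((ncard_wordBall_add _ _).trans (Nat.mul_le_mul_right _ (ncard_wordBall_mul _ _)))
    have := Nat.div_add_mod n m
    have := Nat.mod_lt n hm0
    omega
  calc ((wordBall S n).ncard : ℝ) ≤ ((wordBall S m).ncard : ℝ) ^ (n / m) * (wordBall S m).ncard := by
        exact_mod_cast h1
    _ ≤ (c ^ m) ^ (n / m) * (wordBall S m).ncard := by gcongr
    _ ≤ c ^ n * (wordBall S m).ncard := by
        rw [← pow_mul]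
        gcongr
        · exact hc.le
        · exact Nat.mul_div_le n m
    _ = _ := mul_comm _ _

theorem exists_root_of_one_lt {y : ℝ} (hy : 1 < y) {R : ℕ} (hR : R ≠ 0) :
    ∃ c : ℝ, 1 < c ∧ c ^ R = y :=
  ⟨y ^ (R⁻¹ : ℝ), Real.one_lt_rpow hy (by positivity),
    Real.rpow_inv_natCast_pow (by linarith) hR⟩

theorem hasExponentialGrowth_of_subsequence {R : ℕ} {y : ℝ} (hy : 1 < y)
    (h : ∀ n : ℕ, y ^ n ≤ (wordBall S (R * n)).ncard) : HasExponentialGrowth S := by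
  by_contra hg
  rcases Nat.eq_zero_or_pos R with rfl | hR
  · have := h 1
    simp [wordBall_zero] at this
    linarith
  obtain ⟨z, hz1, hz⟩ := exists_between hy
  obtain ⟨c, hc, hcR⟩ := exists_root_of_one_lt hz1 hR.ne'
  obtain ⟨C, -, hC⟩ := exists_ncard_wordBall_le hg hc
  have hz0 : 0 < z := by linarith
  obtain ⟨n, hn⟩ := pow_unbounded_of_one_lt C ((one_lt_div hz0).2 hz)
  have h1 := (h n).trans (hC (R * n))
  rw [pow_mul, hcR] at h1
  rw [div_pow, lt_div_iff₀ (by positivity)] at hn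
  linarith

variable (S) in
/-- The word length of `g` with respect to `S`. -/
noncomputable def wordLength (g : Γ) : ℕ := sInf {n | g ∈ wordBall S n}

theorem exists_mem_wordBall (hS : Subgroup.closure (S : Set Γ) = ⊤) (g : Γ) :
    ∃ n, g ∈ wordBall S n := by
  have hg : g ∈ Subgroup.closure (S : Set Γ) := hS ▸ Subgroup.mem_top g
  induction hg using Subgroup.closure_induction with
  | mem x hx => exact ⟨1, mem_wordBall_one hx⟩
  | one => exact ⟨0, one_mem_wordBall 0⟩
  | mul x y _ _ hx hy =>
    obtain ⟨m, hm⟩ := hx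
    obtain ⟨n, hn⟩ := hy
    exact ⟨_, mul_mem_wordBall hm hn⟩
  | inv x _ hx =>
    obtain ⟨m, hm⟩ := hx
    exact ⟨m, inv_mem_wordBall hm⟩

theorem wordLength_le_iff (hS : Subgroup.closure (S : Set Γ) = ⊤) {g : Γ} {n : ℕ} :
    wordLength S g ≤ n ↔ g ∈ wordBall S n :=
  ⟨fun h => wordBall_mono h (Nat.sInf_mem (exists_mem_wordBall hS g)), fun h => Nat.sInf_le h⟩

/-- With `1 < c < θ⁻¹`, the sphere of radius `n` contributes at most `C * (c * θ) ^ n`. -/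
theorem summable_pow_wordLength (hS : Subgroup.closure (S : Set Γ) = ⊤)
    (hg : ¬ HasExponentialGrowth S) {θ : ℝ} (h0 : 0 < θ) (h1 : θ < 1) :
    Summable fun x : Γ => θ ^ wordLength S x := by
  classical
  obtain ⟨c, hc1, hc⟩ := exists_between ((one_lt_inv₀ h0).2 h1)
  obtain ⟨C, hC0, hC⟩ := exists_ncard_wordBall_le hg hc1
  have hcθ : c * θ < 1 := by
    rwa [lt_inv_comm₀ (by linarith) h0, ← one_div, lt_div_iff₀ (by linarith), mul_comm] at hc
  have hcθ0 : 0 ≤ c * θ := by positivity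
  refine summable_of_sum_le (c := C * (1 - c * θ)⁻¹) (fun x => by positivity) fun u => ?_
  have hmap : ∀ x ∈ u, wordLength S x ∈ Finset.range (u.sup (wordLength S) + 1) := fun x hx =>
    Finset.mem_range.2 (Nat.lt_succ_of_le (Finset.le_sup hx))
  rw [← Finset.sum_fiberwise_of_maps_to hmap]
  calc _ ≤ ∑ n ∈ Finset.range (u.sup (wordLength S) + 1), C * (c * θ) ^ n := by
        apply Finset.sum_le_sum
        intro n _
        rw [Finset.sum_congr rfl (g := fun _ => θ ^ n)
          (fun x hx => by rw [(Finset.mem_filter.1 hx).2]), Finset.sum_const, nsmul_eq_mul,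
          mul_pow, ← mul_assoc]
        gcongr
        refine le_trans ?_ (hC n)
        rw [Nat.cast_le, ← Set.ncard_coe_finset]
        refine Set.ncard_le_ncard (fun x hx => (wordLength_le_iff hS).1 ?_) (finite_wordBall n)
        exact (Finset.mem_filter.1 (Finset.mem_coe.1 hx)).2.le
    _ ≤ C * (1 - c * θ)⁻¹ := by
        rw [← Finset.mul_sum, ← tsum_geometric_of_lt_one hcθ0 hcθ]
        gcongr
        exact (summable_geometric_of_lt_one hcθ0 hcθ).sum_le_tsum _ fun i _ => by positivity

end WordMetric

end CoexactGap

namespace CoexactGap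

/-! ### Sets with finite coboundary -/

section Ends

variable {Γ : Type*} [Group Γ] {S : Finset Γ}

variable (S) in
/-- Every edge of the Cayley graph joining `A` and its complement has both ends in `K`. -/
def IsCutBy (A K : Set Γ) : Prop :=
  ∀ g, ∀ s ∈ S, ¬ (g ∈ A ↔ g * s ∈ A) → g ∈ K ∧ g * s ∈ K

theorem IsCutBy.mono {A K K' : Set Γ} (h : IsCutBy S A K) (hK : K ⊆ K') : IsCutBy S A K' :=
  fun g s hs hg => ⟨hK (h g s hs hg).1, hK (h g s hs hg).2⟩

theorem IsCutBy.compl {A K : Set Γ} (h : IsCutBy S A K) : IsCutBy S Aᶜ K :=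
  fun g s hs hg => h g s hs fun h' => hg (not_congr h')

/-- The left translate `h A`. -/
def leftTranslate (h : Γ) (A : Set Γ) : Set Γ := {x | h⁻¹ * x ∈ A}

theorem mem_leftTranslate {h x : Γ} {A : Set Γ} : x ∈ leftTranslate h A ↔ h⁻¹ * x ∈ A := Iff.rfl

theorem IsCutBy.leftTranslate {A K : Set Γ} (h : IsCutBy S A K) (g : Γ) :
    IsCutBy S (leftTranslate g A) (leftTranslate g K) := by
  intro x s hs hx
  simp only [mem_leftTranslate, ← mul_assoc] at hx ⊢
  exact h _ s hs hx

/-- A cut set is constant on balls which do not meet the cut. -/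
theorem IsCutBy.mem_iff_mul_mem {A K : Set Γ} (h : IsCutBy S A K) {n : ℕ} {g : Γ}
    (hg : ∀ y ∈ wordBall S n, g * y ∉ K) {x : Γ} (hx : x ∈ wordBall S n) :
    g ∈ A ↔ g * x ∈ A := by
  obtain ⟨l, hl, hl', rfl⟩ := hx
  induction l generalizing g n with
  | nil => simp
  | cons a l ih =>
    match n with
    | 0 => simp at hl
    | n + 1 =>
      have hone : g ∉ K := by simpa using hg 1 (one_mem_wordBall _)
      have haB : a ∈ wordBall S 1 := ⟨[a], by simp, by simpa using hl' a (by simp), by simp⟩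
      have ha : g ∈ A ↔ g * a ∈ A := by
        by_contra hne
        rcases hl' a (by simp) with hs | hs
        · exact hone (h g a hs hne).1
        · have := h (g * a) a⁻¹ hs (by simpa using fun h' => hne h'.symm)
          simp [hone] at this
      rw [ha, List.prod_cons, ← mul_assoc]
      refine ih (n := n) ?_ (by simpa using hl) fun x hx => hl' x (by simp [hx])
      intro y hy
      rw [mul_assoc]
      exact hg _ (by rw [add_comm]; exact mul_mem_wordBall haB hy)

/-- A nonempty set without coboundary is everything. -/
theorem IsCutBy.eq_univ (hS : Subgroup.closure (S : Set Γ) = ⊤) {A : Set Γ}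
    (h : IsCutBy S A ∅) (hA : A.Nonempty) : A = Set.univ := by
  obtain ⟨a, ha⟩ := hA
  ext x
  obtain ⟨n, hn⟩ := exists_mem_wordBall hS (a⁻¹ * x)
  have := (h.mem_iff_mul_mem (g := a) (by simp) hn).1 ha
  simpa using this

/-- An edge leaving one of the sets has both ends in the other one, so the union has empty
coboundary. -/
theorem IsCutBy.union_eq_univ (hS : Subgroup.closure (S : Set Γ) = ⊤) {A A' K K' : Set Γ}
    (h : IsCutBy S A K) (h' : IsCutBy S A' K') (hK : K ⊆ A') (hK' : K' ⊆ A)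
    (hne : (A ∪ A').Nonempty) : A ∪ A' = Set.univ := by
  refine IsCutBy.eq_univ hS ?_ hne
  intro g s hs hg
  have h1 := h g s hs
  have h2 := h' g s hs
  simp only [Set.mem_union] at hg
  have := @hK g
  have := @hK (g * s)
  have := @hK' g
  have := @hK' (g * s)
  tauto

theorem disjoint_of_notMem_wordBall {m : ℕ} {g : Γ} (hg : g ∉ wordBall S (2 * m)) {x : Γ}
    (hx : x ∈ wordBall S m) : g * x ∉ wordBall S m := by
  intro h
  apply hg
  have := mul_mem_wordBall h (inv_mem_wordBall hx)
  rwa [mul_inv_cancel_right, ← two_mul] at this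

theorem inv_notMem_wordBall {m : ℕ} {g : Γ} (hg : g ∉ wordBall S m) : g⁻¹ ∉ wordBall S m :=
  fun h => hg (by simpa using inv_mem_wordBall h)

/-- Two sets with small coboundaries become nested after translating one of them far away. -/
theorem IsCutBy.nested (hS : Subgroup.closure (S : Set Γ) = ⊤) {X Y : Set Γ} {m : ℕ}
    (hX : IsCutBy S X (wordBall S m)) (hY : IsCutBy S Y (wordBall S m)) {g : Γ}
    (hg : g ∉ wordBall S (2 * m)) (hgX : g ∈ X) (hgY : g⁻¹ ∈ Y) (x : Γ) :
    x ∈ X ∨ g⁻¹ * x ∈ Y := by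
  -- The cuts lie in the disjoint balls `B(m)` and `g B(m)`. So `X` is constant on the second ball,
  -- whose centre `g` is in `X`, and `gY` is constant on the first, whose centre is in `gY` because
  -- `g⁻¹ ∈ Y`. Replacing `X` or `Y` by complements yields the other three nesting relations.
  have : X ∪ CoexactGap.leftTranslate g Y = Set.univ := by
    refine IsCutBy.union_eq_univ hS hX (hY.leftTranslate g) ?_ ?_ ⟨g, Or.inl hgX⟩
    · intro y hy
      exact (hY.mem_iff_mul_mem
        (fun z hz => disjoint_of_notMem_wordBall (inv_notMem_wordBall hg) hz) hy).1 hgY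
    · intro y hy
      have := (hX.mem_iff_mul_mem (fun z hz => disjoint_of_notMem_wordBall hg hz) hy).1 hgX
      simpa using this
  exact (this ▸ Set.mem_univ x : x ∈ X ∪ CoexactGap.leftTranslate g Y)

/-- Let `x ∈ A` be outside `B(2m)`. If `x⁻¹ ∈ A`, nesting gives `Γ = A ∪ xA`, which is finite.
Otherwise `xA ⊆ A`, hence `xA = A`; then `x ∈ xA` gives `1 ∈ A`, and `1 ∈ xA` gives `x⁻¹ ∈ A`. -/
theorem IsCutBy.subset_wordBall_of_finite [Infinite Γ] (hS : Subgroup.closure (S : Set Γ) = ⊤)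
    {A : Set Γ} {m : ℕ} (hA : IsCutBy S A (wordBall S m)) (hfin : A.Finite) :
    A ⊆ wordBall S (2 * m) := by
  intro x hx
  by_contra hxm
  by_cases hxA : x⁻¹ ∈ A
  · have h := hA.nested hS hA hxm hx hxA
    refine (hfin.union (hfin.image (x * ·))).infinite_compl.nonempty.elim ?_
    intro y hy
    apply hy
    rcases h y with h | h
    · exact Or.inl h
    · exact Or.inr ⟨_, h, by simp⟩
  · have h := hA.nested hS hA.compl hxm hx hxA
    have hsub : (x * ·) '' A ⊆ A := by
      rintro _ ⟨y, hy, rfl⟩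
      rcases h (x * y) with h | h
      · exact h
      · exact absurd hy (by simpa using h)
    have heq : (x * ·) '' A = A :=
      Set.eq_of_subset_of_ncard_le hsub
        (by rw [Set.ncard_image_of_injective _ (mul_right_injective x)]) hfin
    have h1 : (1 : Γ) ∈ A := by
      rw [← heq] at hx
      obtain ⟨y, hy, hyx⟩ := hx
      simpa [show y = 1 by simpa using hyx] using hy
    rw [← heq] at h1
    obtain ⟨y, hy, hyx⟩ := h1
    rw [eq_inv_of_mul_eq_one_right hyx] at hy
    exact hxA hy

/-! ### Shifts of a cut set, virtually cyclic groups and ping-pong. -/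

theorem pow_mem_of_mapsTo {A : Set Γ} {h : Γ} (hA : ∀ x ∈ A, h * x ∈ A) (hh : h ∈ A) (n : ℕ) :
    h ^ (n + 1) ∈ A := by
  induction n with
  | zero => simpa using hh
  | succ n ih => rw [pow_succ']; exact hA _ ih

/-- An element which shifts `A` into itself, with `h ∈ A` and `h⁻¹ ∉ A`. -/
structure IsShift (A : Set Γ) (h : Γ) : Prop where
  mul_mem : ∀ x ∈ A, h * x ∈ A
  mem : h ∈ A
  inv_notMem : h⁻¹ ∉ A

theorem IsShift.compl {A : Set Γ} {h : Γ} (hA : IsShift A h) : IsShift Aᶜ h⁻¹ where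
  mul_mem x hx hx' := hx (by simpa using hA.mul_mem _ hx')
  mem := hA.inv_notMem
  inv_notMem := by simpa using hA.mem

theorem IsShift.pow_mem {A : Set Γ} {h : Γ} (hA : IsShift A h) (n : ℕ) : h ^ (n + 1) ∈ A :=
  pow_mem_of_mapsTo hA.mul_mem hA.mem n

theorem IsShift.injective_pow {A : Set Γ} {h : Γ} (hA : IsShift A h) :
    Function.Injective fun n : ℕ => h ^ n := by
  rw [injective_pow_iff_not_isOfFinOrder, isOfFinOrder_iff_pow_eq_one]
  rintro ⟨n, hn, h1⟩
  obtain ⟨n, rfl⟩ := Nat.exists_eq_succ_of_ne_zero hn.ne'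
  apply hA.inv_notMem
  -- Twice the period is used so that the exponent stays positive even if `h = 1`.
  have : h⁻¹ = h ^ (2 * n + 1) := by
    rw [inv_eq_iff_mul_eq_one, ← pow_succ', show 2 * n + 1 + 1 = n.succ * 2 by omega, pow_mul, h1,
      one_pow]
  rw [this]
  exact hA.pow_mem _

/-- The positive powers of `h` are distinct elements of `A`, so some power is farther from the cut
than the length of `x`; around it `A` is constant. -/
theorem IsShift.exists_pow_mul_mem (hS : Subgroup.closure (S : Set Γ) = ⊤) {A : Set Γ} {m : ℕ}
    (hA : IsCutBy S A (wordBall S m)) {h : Γ} (hh : IsShift A h) (x : Γ) :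
    ∃ n : ℕ, h ^ n * x ∈ A := by
  by_contra! hx
  obtain ⟨L, hL⟩ := exists_mem_wordBall hS x
  refine Set.infinite_range_of_injective (hh.injective_pow.comp (add_left_injective 1))
    ((finite_wordBall (S := S) (m + L)).subset ?_)
  rintro _ ⟨n, rfl⟩
  by_contra hn
  refine hx (n + 1) ((hA.mem_iff_mul_mem (fun y hy hy' => hn ?_) hL).1 (hh.pow_mem n))
  simpa using mul_mem_wordBall hy' (inv_mem_wordBall hy)

/-- The finite set is `A \ hA`, and it meets every orbit of left multiplication by powers of `h`:
move a point into `A` by a positive power, then go back until the last moment before leaving `A`.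
Inverses appear because Mathlib's quotient consists of the cosets `x⟨h⟩`. -/
theorem IsShift.isVirtuallyInfiniteCyclic (hS : Subgroup.closure (S : Set Γ) = ⊤) {A : Set Γ}
    {m : ℕ} (hA : IsCutBy S A (wordBall S m)) {h : Γ} (hh : IsShift A h)
    (hfin : {x | x ∈ A ∧ h⁻¹ * x ∉ A}.Finite) : IsVirtuallyInfiniteCyclic Γ := by
  classical
  refine ⟨Subgroup.zpowers h, ?_, inferInstance, ?_⟩
  · have := hfin.to_subtype
    have hsurj : Function.Surjective
        fun t : {x | x ∈ A ∧ h⁻¹ * x ∉ A} => (((t : Γ)⁻¹ : Γ) : Γ ⧸ Subgroup.zpowers h) := by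
      intro x
      induction x using QuotientGroup.induction_on with
      | H x =>
        obtain ⟨n, hn⟩ := hh.exists_pow_mul_mem hS hA x⁻¹
        have hex : ∃ k : ℕ, h⁻¹ ^ k * (h ^ n * x⁻¹) ∉ A :=
          hh.compl.exists_pow_mul_mem hS hA.compl (h ^ n * x⁻¹)
        obtain ⟨k, hk, hmin⟩ : ∃ k : ℕ, h⁻¹ ^ k * (h ^ n * x⁻¹) ∉ A ∧
            ∀ j < k, ¬ h⁻¹ ^ j * (h ^ n * x⁻¹) ∉ A :=
          ⟨Nat.find hex, Nat.find_spec hex, fun j => Nat.find_min hex⟩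
        obtain ⟨k, rfl⟩ := Nat.exists_eq_succ_of_ne_zero (n := k) (by rintro rfl; simp [hn] at hk)
        refine ⟨⟨h⁻¹ ^ k * (h ^ n * x⁻¹), not_not.1 (hmin k (Nat.lt_succ_self k)), ?_⟩, ?_⟩
        · rwa [← mul_assoc, ← pow_succ']
        · refine QuotientGroup.eq.2 (Subgroup.mem_zpowers_iff.2 ⟨(n : ℤ) - k, ?_⟩)
          rw [inv_inv]
          change _ = h⁻¹ ^ k * (h ^ n * x⁻¹) * x
          group
    have := Finite.of_surjective _ hsurj
    exact Subgroup.finiteIndex_of_finite_quotient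
  · exact Infinite.of_injective (fun n : ℕ => (⟨h ^ n, n, by simp⟩ : Subgroup.zpowers h))
      fun i j hij => hh.injective_pow (congrArg Subtype.val hij)

/-- Ping-pong: a free semigroup of rank two yields exponential growth. -/
theorem hasExponentialGrowth_of_pingPong (hS : Subgroup.closure (S : Set Γ) = ⊤) {U : Set Γ}
    (hU : U.Nonempty) {a b : Γ} (ha : ∀ x ∈ U, a * x ∈ U) (hb : ∀ x ∈ U, b * x ∈ U)
    (hab : ∀ x ∈ U, ∀ y ∈ U, a * x ≠ b * y) : HasExponentialGrowth S := by
  classical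
  obtain ⟨u, hu⟩ := hU
  obtain ⟨R, haR, hbR⟩ : ∃ R, a ∈ wordBall S R ∧ b ∈ wordBall S R := by
    obtain ⟨m, hm⟩ := exists_mem_wordBall hS a
    obtain ⟨n, hn⟩ := exists_mem_wordBall hS b
    exact ⟨max m n, wordBall_mono (le_max_left _ _) hm, wordBall_mono (le_max_right _ _) hn⟩
  refine hasExponentialGrowth_of_subsequence (R := R) (y := 2) (by norm_num) fun n => ?_
  -- `T` consists of the products of `n` factors `a`, `b`. They are distinct: `a * t = b * t'` would
  -- contradict `hab` at `t * u` and `t' * u`.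
  obtain ⟨T, hTU, hTB, hTc⟩ : ∃ T : Finset Γ, (∀ t ∈ T, t * u ∈ U) ∧
      (∀ t ∈ T, t ∈ wordBall S (R * n)) ∧ T.card = 2 ^ n := by
    induction n with
    | zero => exact ⟨{1}, by simpa using hu, by simpa using one_mem_wordBall _, by simp⟩
    | succ n ih =>
      obtain ⟨T, hTU, hTB, hTc⟩ := ih
      refine ⟨T.image (a * ·) ∪ T.image (b * ·), ?_, ?_, ?_⟩
      · intro t ht
        simp only [Finset.mem_union, Finset.mem_image] at ht
        rcases ht with ⟨t, ht, rfl⟩ | ⟨t, ht, rfl⟩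
        · rw [mul_assoc]; exact ha _ (hTU t ht)
        · rw [mul_assoc]; exact hb _ (hTU t ht)
      · intro t ht
        simp only [Finset.mem_union, Finset.mem_image] at ht
        rw [mul_add, mul_one, add_comm]
        rcases ht with ⟨t, ht, rfl⟩ | ⟨t, ht, rfl⟩
        · exact mul_mem_wordBall haR (hTB t ht)
        · exact mul_mem_wordBall hbR (hTB t ht)
      · rw [Finset.card_union_of_disjoint, Finset.card_image_of_injective _ (mul_right_injective a),
          Finset.card_image_of_injective _ (mul_right_injective b), hTc, pow_succ]
        · omega
        · rw [Finset.disjoint_left]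
          intro t ht ht'
          simp only [Finset.mem_image] at ht ht'
          obtain ⟨x, hx, rfl⟩ := ht
          obtain ⟨y, hy, hxy⟩ := ht'
          refine hab _ (hTU x hx) _ (hTU y hy) ?_
          rw [← mul_assoc, ← hxy, mul_assoc]
  have h1 : T.card ≤ (wordBall S (R * n)).ncard := by
    rw [← Set.ncard_coe_finset]
    exact Set.ncard_le_ncard (fun t ht => hTB t ht) (finite_wordBall _)
  rw [hTc] at h1
  exact_mod_cast h1

/-- Take far elements `g ∈ A` and `k ∉ A`. If `g⁻¹ ∉ A`, nesting gives `gA ⊆ A`; if `k⁻¹ ∈ A`, it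
gives `k⁻¹A ⊆ A`. In the remaining case both elements flip sides, `gAᶜ ⊆ A` and `kA ⊆ Aᶜ`, so `gk`
is a shift. -/
theorem IsCutBy.exists_isShift (hS : Subgroup.closure (S : Set Γ) = ⊤) {A : Set Γ} {m : ℕ}
    (hA : IsCutBy S A (wordBall S m)) (hinf : A.Infinite) (hinf' : Aᶜ.Infinite) :
    ∃ h, IsShift A h := by
  obtain ⟨g, hgA, hg⟩ := hinf.exists_notMem_finite (finite_wordBall (S := S) (2 * m))
  obtain ⟨k, hkA, hk⟩ := hinf'.exists_notMem_finite (finite_wordBall (S := S) (2 * m))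
  by_cases hg' : g⁻¹ ∈ A
  · have h1 := hA.nested hS hA hg hgA hg'
    by_cases hk' : k⁻¹ ∈ A
    · have h2 := hA.nested hS hA.compl (inv_notMem_wordBall hk) hk' (by simpa using hkA)
      refine ⟨k⁻¹, fun x hx => ?_, hk', by simpa using hkA⟩
      have := h2 (k⁻¹ * x)
      simpa [hx] using this
    · have h2 := hA.compl.nested hS hA.compl hk hkA hk'
      have h3 := hA.compl.nested hS hA.compl (inv_notMem_wordBall hk) hk' (by simpa using hkA)
      refine ⟨g * k, fun x hx => ?_, ?_, ?_⟩
      · have e1 := h1 (g * k * x)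
        have e2 := h2 (k * x)
        simp only [inv_mul_cancel_left, Set.mem_compl_iff, mul_assoc] at e1 e2 ⊢
        tauto
      · have e1 := h1 (g * k)
        simp only [inv_mul_cancel_left] at e1
        exact e1.resolve_right hkA
      · have e3 := h3 (k⁻¹ * g⁻¹)
        simp only [inv_inv, mul_inv_cancel_left, Set.mem_compl_iff] at e3
        rw [mul_inv_rev]
        tauto
  · refine ⟨g, fun x hx => ?_, hgA, hg'⟩
    have := hA.nested hS hA.compl hg hgA hg' (g * x)
    simpa [hx] using this

theorem exists_wordBall_superset (hS : Subgroup.closure (S : Set Γ) = ⊤) {K : Set Γ}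
    (hK : K.Finite) : ∃ m, K ⊆ wordBall S m := by
  obtain ⟨m, hm⟩ := (hK.image (wordLength S)).bddAbove
  exact ⟨m, fun x hx => (wordLength_le_iff hS).1 (hm ⟨x, hx, rfl⟩)⟩

/-- If a set with finite coboundary is neither finite nor cofinite, then the group is virtually
infinite cyclic or it has exponential growth. -/
theorem IsCutBy.growth_or_virtually_cyclic (hS : Subgroup.closure (S : Set Γ) = ⊤) {A K : Set Γ}
    (hK : K.Finite) (hA : IsCutBy S A K) (hinf : A.Infinite) (hinf' : Aᶜ.Infinite) :
    HasExponentialGrowth S ∨ IsVirtuallyInfiniteCyclic Γ := by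
  obtain ⟨m, hm⟩ := exists_wordBall_superset hS hK
  obtain ⟨h, hh⟩ := (hA.mono hm).exists_isShift hS hinf hinf'
  by_cases hfin : {x | x ∈ A ∧ h⁻¹ * x ∉ A}.Finite
  · exact Or.inr (hh.isVirtuallyInfiniteCyclic hS (hA.mono hm) hfin)
  left
  obtain ⟨M, hM⟩ := exists_wordBall_superset hS (K := K ∪ CoexactGap.leftTranslate h K)
    (hK.union ((hK.image (h * ·)).subset fun x hx => ⟨h⁻¹ * x, hx, by simp⟩))
  have h1 : IsCutBy S A (wordBall S M) := hA.mono (Set.subset_union_left.trans hM)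
  have h2 : IsCutBy S (CoexactGap.leftTranslate h Aᶜ) (wordBall S M) :=
    (hA.compl.leftTranslate h).mono (Set.subset_union_right.trans hM)
  -- A far element of `A \ hA`, where `M` is large enough for the cuts of both `A` and `hA`.
  obtain ⟨g, ⟨hgA, hgh⟩, hg⟩ := Set.Infinite.exists_notMem_finite hfin
    (finite_wordBall (S := S) (2 * M))
  by_cases hg' : g⁻¹ ∈ A
  -- Here nesting gives `gAᶜ ⊆ hAᶜ` and `gAᶜ ⊆ A`, so `h⁻¹Aᶜ` and `h⁻¹gAᶜ` are disjoint subsets of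
  -- `Aᶜ`.
  · refine hasExponentialGrowth_of_pingPong hS hinf'.nonempty (a := h⁻¹) (b := h⁻¹ * g)
      hh.compl.mul_mem ?_ ?_
    · intro x hx
      have := h2.nested hS h1 hg hgh hg' (g * x)
      simp only [inv_mul_cancel_left, mem_leftTranslate] at this
      rw [mul_assoc]
      exact this.resolve_right hx
    · intro x hx y hy hxy
      rw [mul_assoc, mul_right_inj] at hxy
      have := h1.nested hS h1 hg hgA hg' (g * y)
      rw [inv_mul_cancel_left] at this
      exact hx (hxy ▸ this.resolve_right hy)
  -- Here `gA ⊆ A \ hA`, so `hA` and `gA` are disjoint subsets of `A`.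
  · refine hasExponentialGrowth_of_pingPong hS hinf.nonempty (a := h) (b := g) hh.mul_mem ?_ ?_
    · intro x hx
      have := h1.nested hS h1.compl hg hgA hg' (g * x)
      rw [inv_mul_cancel_left] at this
      exact this.resolve_right (not_not.2 hx)
    · intro x hx y hy hxy
      have := h2.nested hS h1.compl hg hgh hg' (g * y)
      rw [inv_mul_cancel_left, ← hxy] at this
      simp only [mem_leftTranslate, inv_mul_cancel_left, Set.mem_compl_iff] at this
      tauto

end Ends

end CoexactGap

namespace CoexactGap

/-! ### Cocycles are coboundaries -/

namespace OrientedGraph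

variable {V E : Type*} {G : OrientedGraph V E}

/-- The value of a `1`-cochain on an edge passed in its direction or in the reversed one. -/
def evalStep (q : E → ℝ) (a : E × Bool) : ℝ := (if a.2 then 1 else -1) * q a.1

theorem Cycle.finite_edgeSet (γ : G.Cycle) : γ.edgeSet.Finite := by
  have := γ.len_pos
  exact Set.finite_range _

theorem Cycle.chain_step (γ : G.Cycle) (i : ZMod γ.len) :
    γ.chain (γ.step i).1 = if (γ.step i).2 then 1 else -1 := by
  classical
  have := γ.len_pos
  unfold Cycle.chain
  rw [Finset.sum_eq_single i]
  · rw [if_pos rfl]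
  · intro j _ hj
    exact if_neg fun h => hj (γ.edge_injective h)
  · simp

theorem Cycle.sum_edgeSet (γ : G.Cycle) [Fintype (ZMod γ.len)] (f : E → ℝ) :
    ∑ e ∈ γ.finite_edgeSet.toFinset, f e = ∑ i, f (γ.step i).1 := by
  classical
  have : γ.finite_edgeSet.toFinset = Finset.univ.image fun i => (γ.step i).1 := by
    ext e
    simp [Cycle.edgeSet]
  rw [this, Finset.sum_image fun i _ j _ h => γ.edge_injective h]

theorem Cycle.finsum_chain_mul (γ : G.Cycle) [Fintype (ZMod γ.len)] (q : E → ℝ) :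
    ∑ᶠ e, γ.chain e * q e = ∑ i, evalStep q (γ.step i) := by
  rw [finsum_eq_sum_of_support_subset (s := γ.finite_edgeSet.toFinset), γ.sum_edgeSet]
  · exact Finset.sum_congr rfl fun i _ => by rw [γ.chain_step]; rfl
  · intro e he
    by_contra hn
    exact he (mul_eq_zero_of_left (γ.chain_eq_zero (by simpa using hn)) _)

/-- A closed chain supported on a simple cycle is a multiple of the chain of this cycle. -/
theorem Cycle.exists_eq_smul_chain (γ : G.Cycle) (c : E → ℝ) (hc : ∀ e ∉ γ.edgeSet, c e = 0)
    (hb : ∀ v, ∑ e ∈ γ.finite_edgeSet.toFinset, c e * G.inc₁ e v = 0) :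
    ∃ a : ℝ, ∀ e, c e = a * γ.chain e := by
  classical
  have := γ.len_pos
  have hinc : ∀ i v, c (γ.step i).1 * G.inc₁ (γ.step i).1 v = evalStep c (γ.step i) *
      ((if G.src (γ.step (i + 1)) = v then 1 else 0) - (if G.src (γ.step i) = v then 1 else 0)) := by
    intro i v
    rw [← γ.closed i]
    unfold inc₁ src tgt evalStep
    cases (γ.step i).2 <;> simp
    ring
  -- Conservation of flow: the only steps of the cycle at this vertex are `j`, which enters, and `j
  -- + 1`, which leaves.
  have hstep : ∀ j, evalStep c (γ.step (j + 1)) = evalStep c (γ.step j) := by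
    intro j
    have h := hb (G.src (γ.step (j + 1)))
    rw [γ.sum_edgeSet, Finset.sum_congr rfl fun i _ => hinc i _] at h
    have e1 : ∀ i k, G.src (γ.step i) = G.src (γ.step k) ↔ i = k :=
      fun i k => γ.vertex_injective.eq_iff
    simp only [e1, add_left_inj, mul_sub, mul_ite, mul_one, mul_zero, Finset.sum_sub_distrib,
      Finset.sum_ite_eq', Finset.mem_univ, if_true] at h
    linarith
  have hconst : ∀ n : ℕ, evalStep c (γ.step n) = evalStep c (γ.step 0) := by
    intro n
    induction n with
    | zero => simp
    | succ n ih => rw [Nat.cast_succ, hstep, ih]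
  refine ⟨evalStep c (γ.step 0), fun e => ?_⟩
  by_cases he : e ∈ γ.edgeSet
  · obtain ⟨i, rfl⟩ := he
    have := hconst i.val
    rw [ZMod.natCast_zmod_val] at this
    rw [← this]
    simp only [γ.chain_step, evalStep]
    split_ifs <;> simp
  · rw [hc e he, γ.chain_eq_zero he, mul_zero]

/-- Simple cycles with the same set of edges have proportional chains. -/
theorem Cycle.exists_chain_eq_smul (γ γ' : G.Cycle) (h : γ.edgeSet = γ'.edgeSet) :
    ∃ a : ℝ, ∀ e, γ.chain e = a * γ'.chain e := by
  refine γ'.exists_eq_smul_chain γ.chain (fun e he => γ.chain_eq_zero (h ▸ he)) fun v => ?_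
  exact γ.sum_chain_mul_inc₁ v _ (by rw [h]; simp)

/-- A cochain which vanishes on a cycle vanishes on all cycles with the same edges. -/
theorem Cycle.sum_evalStep_eq_zero (γ γ' : G.Cycle) [Fintype (ZMod γ.len)]
    (h : γ.edgeSet = γ'.edgeSet) {q : E → ℝ}
    (hq : ∑ᶠ e, γ'.chain e * q e = 0) : ∑ i, evalStep q (γ.step i) = 0 := by
  obtain ⟨a, ha⟩ := γ.exists_chain_eq_smul γ' h
  rw [← γ.finsum_chain_mul]
  simp_rw [ha, mul_assoc]
  rw [← mul_finsum, hq, mul_zero]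

end OrientedGraph

/-! ### Closed walks, and potentials from a presentation. -/

section Words

open OrientedGraph

variable {Γ : Type*} [Group Γ] {S : Finset Γ}

/-- The element of the group given by a letter. -/
def letterVal (a : S × Bool) : Γ := cond a.2 (a.1 : Γ) (a.1 : Γ)⁻¹

/-- The element of the group given by a word. -/
def wordVal (l : List (S × Bool)) : Γ := (l.map letterVal).prod

theorem wordVal_nil : wordVal ([] : List (S × Bool)) = 1 := rfl

theorem wordVal_cons (a : S × Bool) (l : List (S × Bool)) :
    wordVal (a :: l) = letterVal a * wordVal l := by simp [wordVal]

theorem wordVal_append (l l' : List (S × Bool)) : wordVal (l ++ l') = wordVal l * wordVal l' := by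
  simp [wordVal]

theorem lift_mk_eq_wordVal (l : List (S × Bool)) :
    FreeGroup.lift (fun s : S => (s : Γ)) (FreeGroup.mk l) = wordVal l := rfl

/-- The oriented edge which starts in `g` and is labelled by the letter `a`. -/
def letterStep (g : Γ) (a : S × Bool) : (Γ × S) × Bool :=
  (cond a.2 (g, a.1) (g * (a.1 : Γ)⁻¹, a.1), a.2)

theorem src_letterStep (g : Γ) (a : S × Bool) : (cayley S).src (letterStep g a) = g := by
  obtain ⟨s, _ | _⟩ := a <;> simp [letterStep, src, cayley]

theorem tgt_letterStep (g : Γ) (a : S × Bool) :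
    (cayley S).tgt (letterStep g a) = g * letterVal a := by
  obtain ⟨s, _ | _⟩ := a <;> simp [letterStep, tgt, cayley, letterVal]

/-- The sum of a `1`-cochain along the path which starts in `g` and is labelled by a word. -/
def pathSum (q : Γ × S → ℝ) : Γ → List (S × Bool) → ℝ
  | _, [] => 0
  | g, a :: l => evalStep q (letterStep g a) + pathSum q (g * letterVal a) l

theorem pathSum_append (q : Γ × S → ℝ) (g : Γ) (l l' : List (S × Bool)) :
    pathSum q g (l ++ l') = pathSum q g l + pathSum q (g * wordVal l) l' := by
  induction l generalizing g with
  | nil => simp [pathSum, wordVal_nil]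
  | cons a l ih =>
    rw [List.cons_append, pathSum, pathSum, ih, wordVal_cons, mul_assoc, add_assoc]

theorem pathSum_eq_sum (q : Γ × S → ℝ) (g : Γ) (l : List (S × Bool)) :
    pathSum q g l = ∑ i : Fin l.length, evalStep q (letterStep (g * wordVal (l.take i)) l[i]) := by
  induction l generalizing g with
  | nil => simp [pathSum]
  | cons a l ih =>
    rw [pathSum, ih]
    refine Eq.trans ?_ (Fin.sum_univ_succ (n := l.length) _).symm
    simp [wordVal_nil, wordVal_cons, mul_assoc]

theorem wordVal_take_succ (l : List (S × Bool)) {i : ℕ} (hi : i < l.length) :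
    wordVal (l.take (i + 1)) = wordVal (l.take i) * letterVal l[i] := by
  rw [List.take_succ_eq_append_getElem hi, wordVal_append]
  simp [wordVal_cons, wordVal_nil]

/-- A `1`-cochain which vanishes on simple cycles of length at most `D` vanishes on all closed
walks of length at most `D`. -/
theorem pathSum_eq_zero_of_length_le {D : ℕ} {q : Γ × S → ℝ}
    (hq : ∀ (γ : (cayley S).Cycle) [Fintype (ZMod γ.len)], γ.len ≤ D →
      ∑ i, evalStep q (γ.step i) = 0)
    (n : ℕ) : ∀ (l : List (S × Bool)), l.length = n → n ≤ D → wordVal l = 1 →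
      ∀ g, pathSum q g l = 0 := by
  induction n using Nat.strong_induction_on with
  | _ n ih =>
  intro l hn hD h1 g
  match n, ih with
  | 0, _ =>
    rw [List.length_eq_zero_iff.1 hn]
    rfl
  | m + 1, ih =>
  let p : Fin (m + 1) → Γ := fun i => g * wordVal (l.take i)
  let st : Fin (m + 1) → (Γ × S) × Bool := fun i => letterStep (p i) (l[(i : ℕ)]'(by omega))
  have hsum : pathSum q g l = ∑ i, evalStep q (st i) := by
    rw [pathSum_eq_sum]
    exact Fintype.sum_equiv (finCongr hn) _ _ fun i => rfl
  have hsrc : ∀ i, (cayley S).src (st i) = p i := fun i => src_letterStep _ _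
  have htgt : ∀ i, (cayley S).tgt (st i) = p (i + 1) := by
    intro i
    change (cayley S).tgt (letterStep _ _) = _
    rw [tgt_letterStep]
    change g * _ * _ = g * _
    rw [mul_assoc, ← wordVal_take_succ, Fin.val_add_one]
    split_ifs with hi
    · subst hi
      rw [Fin.val_last, ← hn, List.take_length, h1]
      simp [wordVal_nil]
    · rfl
  by_cases hinj : Function.Injective p
  · by_cases hedge : Function.Injective fun i => (st i).1
    · rw [hsum]
      let γ : (cayley S).Cycle :=
        { len := m + 1
          len_pos := ⟨Nat.succ_ne_zero m⟩
          step := st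
          closed := fun i => (htgt i).trans (hsrc _).symm
          vertex_injective := fun i j h => hinj ((hsrc i).symm.trans (h.trans (hsrc j)))
          edge_injective := hedge }
      exact hq γ hD
    -- With distinct vertices, an edge can be repeated only in opposite directions. This forces
    -- length two, a walk forth and back, whose terms cancel.
    · obtain ⟨i, j, hij, hne⟩ : ∃ i j, (st i).1 = (st j).1 ∧ i ≠ j := by
        simpa [Function.Injective] using hedge
      have hb : (st i).2 ≠ (st j).2 := by
        intro h
        apply hne
        apply hinj
        rw [← hsrc, ← hsrc, Prod.ext hij h]
      have hsw : ∀ i j, (st i).1 = (st j).1 → (st i).2 ≠ (st j).2 → p i = p (j + 1) := by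
        intro i j hij hb
        rw [← hsrc, ← htgt]
        unfold src tgt
        rw [hij]
        revert hb
        cases (st i).2 <;> cases (st j).2 <;> simp
      have e1 := hinj (hsw i j hij hb)
      have e2 := hinj (hsw j i hij.symm hb.symm)
      have hm : m = 1 := by
        have h1 := congrArg Fin.val e1
        have h2 := congrArg Fin.val e2
        have hne' : (i : ℕ) ≠ j := fun h => hne (Fin.ext h)
        rw [Fin.val_add_one] at h1 h2
        simp only [Fin.ext_iff, Fin.val_last] at h1 h2
        split_ifs at h1 h2 <;> omega
      subst hm
      have hz : ∀ i j, (st i).1 = (st j).1 → (st i).2 ≠ (st j).2 →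
          evalStep q (st i) + evalStep q (st j) = 0 := by
        intro i j hij hb
        unfold evalStep
        rw [hij]
        revert hb
        cases (st i).2 <;> cases (st j).2 <;> simp
      rw [hsum, Fin.sum_univ_two]
      fin_cases i <;> fin_cases j
      · exact absurd rfl hne
      · exact hz _ _ hij hb
      · exact hz _ _ hij.symm hb.symm
      · exact absurd rfl hne
  -- A repeated vertex splits the walk into two strictly shorter closed walks.
  · obtain ⟨i, j, hij, hlt⟩ : ∃ i j, p i = p j ∧ i < j := by
      simp only [Function.Injective, not_forall] at hinj
      obtain ⟨i, j, hij, hne⟩ := hinj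
      rcases lt_or_gt_of_ne hne with h | h
      exacts [⟨i, j, hij, h⟩, ⟨j, i, hij.symm, h⟩]
    have hlt' : (i : ℕ) < j := hlt
    have hj := j.2
    have hw : wordVal (l.take i) = wordVal (l.take j) := mul_left_cancel hij
    have hdec : l.take j = l.take i ++ (l.take j).drop i := by
      conv_lhs => rw [← List.take_append_drop i (l.take j)]
      rw [List.take_take, min_eq_left hlt'.le]
    have hmid : wordVal ((l.take j).drop i) = 1 := by
      rw [hdec, wordVal_append] at hw
      simpa using hw
    have htot : wordVal (l.take i) * wordVal (l.drop j) = 1 := by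
      rw [hw, ← wordVal_append, List.take_append_drop, h1]
    have hs1 : pathSum q (g * wordVal (l.take i)) ((l.take j).drop i) = 0 :=
      ih (j - i) (by omega) _ (by simp; omega) (by omega) hmid _
    have hs2 : pathSum q g (l.take i ++ l.drop j) = 0 :=
      ih (i + (m + 1 - j)) (by omega) _ (by simp; omega) (by omega)
        (by rw [wordVal_append, htot]) _
    rw [← List.take_append_drop j l, pathSum_append, hdec, pathSum_append, ← hdec, ← hw, hs1]
    rw [pathSum_append] at hs2
    linarith

/-- The permutation of `Γ × ℝ` which lifts the right translation by a generator. -/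
def liftPerm (q : Γ × S → ℝ) (s : S) : Equiv.Perm (Γ × ℝ) where
  toFun x := (x.1 * s, x.2 + q (x.1, s))
  invFun x := (x.1 * (s : Γ)⁻¹, x.2 - q (x.1 * (s : Γ)⁻¹, s))
  left_inv x := by simp
  right_inv x := by simp

/-- The right action of the free group on `Γ × ℝ` given by a `1`-cochain. -/
def liftHom (q : Γ × S → ℝ) : FreeGroup S →* (Equiv.Perm (Γ × ℝ))ᵐᵒᵖ :=
  FreeGroup.lift fun s => MulOpposite.op (liftPerm q s)

theorem liftHom_mk (q : Γ × S → ℝ) (l : List (S × Bool)) (x : Γ × ℝ) :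
    (liftHom q (FreeGroup.mk l)).unop x = (x.1 * wordVal l, x.2 + pathSum q x.1 l) := by
  induction l generalizing x with
  | nil => simp [liftHom, wordVal_nil, pathSum]
  | cons a l ih =>
    have : FreeGroup.mk (a :: l) = FreeGroup.mk [a] * FreeGroup.mk l := by
      rw [FreeGroup.mul_mk]; rfl
    have hl : (liftHom q (FreeGroup.mk [a])).unop x =
        (x.1 * letterVal a, x.2 + evalStep q (letterStep x.1 a)) := by
      obtain ⟨s, _ | _⟩ := a
      · have : (liftHom q (FreeGroup.mk [(s, false)])).unop = (liftPerm q s)⁻¹ := by simp [liftHom]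
        rw [this]
        refine Prod.ext rfl ?_
        change x.2 - q _ = _
        simp [letterStep, evalStep, sub_eq_add_neg]
      · have : (liftHom q (FreeGroup.mk [(s, true)])).unop = liftPerm q s := by simp [liftHom]
        rw [this]
        refine Prod.ext rfl ?_
        change x.2 + q _ = _
        simp [letterStep, evalStep]
    rw [this, map_mul, MulOpposite.unop_mul, Equiv.Perm.mul_apply, hl, ih, wordVal_cons, pathSum,
      mul_assoc, add_assoc]

/-- In the Cayley graph of a presentation, a `1`-cochain which vanishes on the simple cycles of
length at most `D` is a coboundary. -/
theorem exists_potential_of_cycles {R : Set (List (S × Bool))} (hSR : IsPresentation S R) {D : ℕ}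
    (hD : ∀ r ∈ R, r.length ≤ D) {q : Γ × S → ℝ}
    (hq : ∀ (γ : (cayley S).Cycle) [Fintype (ZMod γ.len)], γ.len ≤ D →
      ∑ i, evalStep q (γ.step i) = 0) :
    ∃ u : Γ → ℝ, ∀ (g : Γ) (s : S), q (g, s) = u (g * s) - u g := by
  classical
  -- The free group acts on the line bundle `Γ × ℝ` by lifting paths with `q`. Relators have no
  -- monodromy, so the action factors through `Γ`; the potential at `x` is the height reached above
  -- `x` from `(1, 0)`.
  have hker : (FreeGroup.lift fun s : S => (s : Γ)).ker ≤ (liftHom q).ker := by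
    rw [← hSR.2]
    apply Subgroup.normalClosure_le_normal
    rintro _ ⟨r, hr, rfl⟩
    have h1 : wordVal r = 1 := by
      rw [← lift_mk_eq_wordVal, ← MonoidHom.mem_ker, ← hSR.2]
      exact Subgroup.subset_normalClosure ⟨r, hr, rfl⟩
    rw [SetLike.mem_coe, MonoidHom.mem_ker]
    apply MulOpposite.unop_injective
    ext1 x
    rw [liftHom_mk, h1, pathSum_eq_zero_of_length_le hq _ r rfl (hD r hr) h1]
    simp
  have hsurj : Function.Surjective (FreeGroup.lift fun s : S => (s : Γ)) := by
    rw [FreeGroup.lift_surjective_iff_closure_range_eq_top,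
      show (Set.range fun s : S => (s : Γ)) = S from Subtype.range_coe]
    exact hSR.1
  choose w hw using hsurj
  refine ⟨fun x => ((liftHom q (w x)).unop (1, 0)).2, fun g s => ?_⟩
  have h1 : liftHom q (w (g * s)) = liftHom q (w g * FreeGroup.of s) := by
    rw [← inv_mul_eq_one, ← map_inv, ← map_mul, ← MonoidHom.mem_ker]
    apply hker
    simp [MonoidHom.mem_ker, hw]
  have h2 : ((liftHom q (w g)).unop (1, 0)).1 = g := by
    conv_rhs => rw [← hw g]
    rw [← FreeGroup.mk_toWord (x := w g), liftHom_mk, lift_mk_eq_wordVal, one_mul]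
  simp only [h1, map_mul, MulOpposite.unop_mul, Equiv.Perm.mul_apply]
  have h3 : (liftHom q (FreeGroup.of s)).unop = liftPerm q s := by simp [liftHom]
  rw [h3]
  change _ = _ + q (_, s) - _
  rw [h2]
  ring

/-- In the Cayley complex of a presentation, cocycles are coboundaries. -/
theorem exists_potential {R : Set (List (S × Bool))} (hSR : IsPresentation S R) {D : ℕ}
    (hD : ∀ r ∈ R, r.length ≤ D) (o : (cayley S).FaceOrientation D) {q : L2 (Γ × S)}
    (hq : d₁ o q = 0) : ∃ u : Γ → ℝ, ∀ (g : Γ) (s : S), q (g, s) = u (g * s) - u g := by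
  refine exists_potential_of_cycles hSR hD fun γ _ hγ => ?_
  have h := congrArg (fun f : L2 ((cayley S).Face D) => f ⟨γ.edgeSet, γ, hγ, rfl⟩) hq
  -- The orientation chosen for the face may be another cycle with the same edges, whence the
  -- comparison of chains.
  exact γ.sum_evalStep_eq_zero _ (o ⟨γ.edgeSet, γ, hγ, rfl⟩).2.2.symm h

end Words

end CoexactGap

namespace CoexactGap

open ContinuousLinearMap
open scoped RealInnerProductSpace

/-! ### Operators given by incidence numbers: adjoints and decay of the projection -/

section Operators

variable {I J : Type*}

theorem inner_single_one [DecidableEq I] (f : L2 I) (i : I) :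
    ⟪(lp.single 2 i (1 : ℝ) : L2 I), f⟫ = f i := by
  rw [lp.inner_single_left]
  simp

theorem incCLM_single [DecidableEq I] (A : J → I → ℝ) (hA : BoundedIncidence A) (i : I) (j : J) :
    incCLM A hA (lp.single 2 i (1 : ℝ)) j = A j i := by
  rw [incCLM_apply, finsum_eq_single _ i]
  · simp
  · intro k hk
    rw [lp.single_apply_ne _ _ _ hk, mul_zero]

theorem adjoint_incCLM (A : J → I → ℝ) (hA : BoundedIncidence A) :
    adjoint (incCLM A hA) = incCLM (fun i j => A j i) hA.transpose := by
  classical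
  ext g i
  rw [← inner_single_one, adjoint_inner_right, lp.inner_eq_tsum, incCLM_apply, tsum_eq_finsum]
  · apply finsum_congr
    intro j
    rw [incCLM_single]
    simp [mul_comm]
  · have hA' := hA
    obtain ⟨M, -, -, h3⟩ := hA'
    obtain ⟨t, -, ht⟩ := h3 i
    refine t.finite_toSet.subset fun j hj => ht j fun h => hj ?_
    exact (congrArg (fun x : ℝ => ⟪x, g j⟫) ((incCLM_single A hA i j).trans h)).trans
      (inner_zero_left _)

theorem abs_apply_le_norm (f : L2 I) (i : I) : |f i| ≤ ‖f‖ := by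
  simpa using lp.norm_apply_le_norm (p := 2) (by norm_num) f i

variable {H F : Type*} [NormedAddCommGroup H] [InnerProductSpace ℝ H] [CompleteSpace H]
  [NormedAddCommGroup F] [InnerProductSpace ℝ F] [CompleteSpace F]

theorem norm_adjoint_apply_sq_le (d : H →L[ℝ] F) (f : H) :
    ‖adjoint d (d f)‖ ^ 2 ≤ ‖d‖ ^ 2 * ‖d f‖ ^ 2 := by
  have h := (adjoint d).le_opNorm (d f)
  rw [LinearIsometryEquiv.norm_map] at h
  rw [← mul_pow]
  gcongr

/-- The Richardson iteration for `d* d` contracts a subspace on which `d` is bounded below. -/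
theorem exists_richardson_contraction (d : H →L[ℝ] F) (K : Submodule ℝ H) {ε : ℝ} (hε : 0 < ε)
    (hK : ∀ f ∈ K, ε * ‖f‖ ^ 2 ≤ ‖d f‖ ^ 2) :
    ∃ a ρ : ℝ, 0 < ρ ∧ ρ < 1 ∧ ∀ f ∈ K, ‖f - a • adjoint d (d f)‖ ≤ ρ * ‖f‖ := by
  -- `M ≥ ‖d‖ ^ 2` lets the quadratic term absorb only half of the cross term, and `M ≥ 2 * ε` keeps
  -- `1 - ε / M` positive.
  set M : ℝ := ‖d‖ ^ 2 + 2 * ε with hM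
  have hM0 : 0 < M := by positivity
  have hεM : ε / M ≤ 1 / 2 := by
    rw [div_le_div_iff₀ hM0 two_pos]
    nlinarith [sq_nonneg ‖d‖]
  have hεM0 : 0 < ε / M := by positivity
  refine ⟨M⁻¹, √(1 - ε / M), Real.sqrt_pos.2 (by linarith), ?_, fun f hf => ?_⟩
  · rw [Real.sqrt_lt' one_pos]
    linarith
  · refine le_of_sq_le_sq ?_ (by positivity)
    rw [mul_pow, Real.sq_sqrt (by linarith), norm_sub_sq_real, inner_smul_right,
      adjoint_inner_right, real_inner_self_eq_norm_sq, norm_smul, mul_pow, Real.norm_eq_abs,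
      sq_abs]
    have h1 := norm_adjoint_apply_sq_le d f
    have h2 := hK f hf
    have h3 : M⁻¹ ^ 2 * ‖adjoint d (d f)‖ ^ 2 ≤ M⁻¹ * ‖d f‖ ^ 2 := by
      calc M⁻¹ ^ 2 * ‖adjoint d (d f)‖ ^ 2 ≤ M⁻¹ ^ 2 * (M * ‖d f‖ ^ 2) := by
            gcongr
            exact h1.trans (by gcongr; linarith)
        _ = M⁻¹ * ‖d f‖ ^ 2 := by field_simp
    have h4 : M⁻¹ * (ε * ‖f‖ ^ 2) ≤ M⁻¹ * ‖d f‖ ^ 2 := by gcongr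
    have h5 : ε / M * ‖f‖ ^ 2 = M⁻¹ * (ε * ‖f‖ ^ 2) := by field_simp
    nlinarith

end Operators

/-! ### The spectral gap and the projection to cocycles. -/

section Projection

variable {Γ : Type*} [Group Γ] {S : Finset Γ} {D : ℕ} (o : (cayley S).FaceOrientation D)

theorem adjoint_d₀ : adjoint (d₀ S) = bd₁ S := adjoint_incCLM _ _

theorem adjoint_d₁ : adjoint (d₁ o) = bd₂ o := adjoint_incCLM _ _

theorem bd₁_eq_zero_of_mem_coexactSpace {f : L2 (Γ × S)} (hf : f ∈ coexactSpace S) :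
    bd₁ S f = 0 := by
  have : coexactSpace S ≤ (bd₁ S).ker :=
    Submodule.topologicalClosure_minimal _ (fun f hf => hf.1) (bd₁ S).isClosed_ker
  exact this hf

theorem bd₂_d₁_mem_coexactSpace {f : L2 (Γ × S)} (hf : f ∈ coexactSpace S) :
    bd₂ o (d₁ o f) ∈ coexactSpace S := by
  have := hodgeLaplacian_mem o f hf
  simpa [hodgeLaplacian, bd₁_eq_zero_of_mem_coexactSpace hf] using this

/-- The values of `d₁ o f` are inner products of `f` with boundaries of single faces, which are
finitely supported cycles. -/
theorem d₁_eq_zero_of_mem_orthogonal {f : L2 (Γ × S)} (hf : f ∈ (coexactSpace S)ᗮ) :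
    d₁ o f = 0 := by
  classical
  ext σ
  rw [← inner_single_one, ← adjoint_inner_left, adjoint_d₁]
  refine Submodule.inner_right_of_mem_orthogonal (Submodule.le_topologicalClosure _ ?_) hf
  refine ⟨bd₁_bd₂ o _, finite_support_incCLM _ _ _ ?_⟩
  exact (Set.finite_singleton σ).subset (by simpa using Pi.support_single_subset)

/-- The spectral gap bounds `d` from below on the coexact space. -/
theorem HasCoexactSpectralGap.exists_lower_bound {o : (cayley S).FaceOrientation D}
    (hgap : HasCoexactSpectralGap o) :
    ∃ ε : ℝ, 0 < ε ∧ ∀ f ∈ coexactSpace S, ε * ‖f‖ ^ 2 ≤ ‖d₁ o f‖ ^ 2 := by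
  obtain ⟨ε, hε, hspec⟩ := hgap
  have h0 : (0 : ℝ) ∉ spectrum ℝ (coexactLaplacian o) := fun h =>
    Set.notMem_empty (0 : ℝ) (hspec ▸ ⟨h, le_refl 0, hε⟩)
  rw [spectrum.zero_notMem_iff] at h0
  obtain ⟨B, hB⟩ := h0.exists_left_inv
  -- On the coexact space the Laplacian is `∂d`, so `‖f‖ ≤ ‖B‖ ‖∂df‖ ≤ ‖B‖ ‖d‖ ‖df‖`. The `+ 1`
  -- keeps the constant positive.
  refine ⟨((‖B‖ * ‖d₁ o‖) ^ 2 + 1)⁻¹, by positivity, fun f hf => ?_⟩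
  have h1 : ‖f‖ ≤ ‖B‖ * ‖bd₂ o (d₁ o f)‖ := by
    have h2 := B.le_opNorm (coexactLaplacian o ⟨f, hf⟩)
    rw [show B (coexactLaplacian o ⟨f, hf⟩) = ⟨f, hf⟩ from congrArg (fun T => T ⟨f, hf⟩) hB] at h2
    have h3 : ‖coexactLaplacian o ⟨f, hf⟩‖ = ‖bd₂ o (d₁ o f)‖ := by
      change ‖hodgeLaplacian o f‖ = _
      simp [hodgeLaplacian, bd₁_eq_zero_of_mem_coexactSpace hf]
    rwa [h3] at h2
  have h2 := norm_adjoint_apply_sq_le (d₁ o) f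
  rw [adjoint_d₁] at h2
  rw [inv_mul_le_iff₀ (by positivity)]
  calc ‖f‖ ^ 2 ≤ (‖B‖ * ‖bd₂ o (d₁ o f)‖) ^ 2 := by gcongr
    _ = ‖B‖ ^ 2 * ‖bd₂ o (d₁ o f)‖ ^ 2 := by ring
    _ ≤ ‖B‖ ^ 2 * (‖d₁ o‖ ^ 2 * ‖d₁ o f‖ ^ 2) := by gcongr
    _ ≤ ((‖B‖ * ‖d₁ o‖) ^ 2 + 1) * ‖d₁ o f‖ ^ 2 := by nlinarith [sq_nonneg ‖d₁ o f‖]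

theorem mem_of_inc₂_ne_zero {o : (cayley S).FaceOrientation D} {σ : (cayley S).Face D} {e : Γ × S}
    (h : OrientedGraph.inc₂ o σ e ≠ 0) : e ∈ σ.1 := by
  by_contra hn
  exact h ((o σ).1.chain_eq_zero (by rwa [(o σ).2.2]))

/-- The operator `∂ d` on `1`-cochains has finite propagation. -/
theorem exists_propagation (hS : Subgroup.closure (S : Set Γ) = ⊤) :
    ∃ r : ℕ, ∀ (g : Γ) (k : ℕ) (f : L2 (Γ × S)), (∀ e, f e ≠ 0 → g⁻¹ * e.1 ∈ wordBall S k) →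
      ∀ e, bd₂ o (d₁ o f) e ≠ 0 → g⁻¹ * e.1 ∈ wordBall S (k + r) := by
  obtain ⟨B, hB, h⟩ := cayley_face_near S D
  obtain ⟨r, hr⟩ := exists_wordBall_superset hS hB
  refine ⟨r, fun g k f hf e he => ?_⟩
  obtain ⟨σ, hσ⟩ : ∃ σ, OrientedGraph.inc₂ o σ e * d₁ o f σ ≠ 0 := by
    by_contra! h0
    exact he (finsum_eq_zero_of_forall_eq_zero h0)
  obtain ⟨e', he'⟩ : ∃ e', OrientedGraph.inc₂ o σ e' * f e' ≠ 0 := by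
    by_contra! h0
    exact right_ne_zero_of_mul hσ (finsum_eq_zero_of_forall_eq_zero h0)
  have h1 := mem_of_inc₂_ne_zero (left_ne_zero_of_mul hσ)
  have h2 := mem_of_inc₂_ne_zero (left_ne_zero_of_mul he')
  have h3 := hf e' (right_ne_zero_of_mul he')
  obtain ⟨γ, hγ, hγσ⟩ := σ.2
  rw [← hγσ] at h1 h2
  have := mul_mem_wordBall h3 (hr (h γ hγ e' h2 e h1))
  simpa [mul_assoc] using this

/-- The projection to the cocycles of the delta function of an edge decays exponentially. -/
theorem exists_decaying_projection [DecidableEq (Γ × S)] (hS : Subgroup.closure (S : Set Γ) = ⊤)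
    {o : (cayley S).FaceOrientation D} (hgap : HasCoexactSpectralGap o) :
    ∃ (ρ : ℝ) (r : ℕ), 0 < ρ ∧ ρ < 1 ∧ ∀ e : Γ × S, ∃ q : L2 (Γ × S), d₁ o q = 0 ∧
      bd₁ S (lp.single 2 e (1 : ℝ) - q) = 0 ∧ ‖q‖ ≤ 1 ∧
      ∀ (e' : Γ × S) (n : ℕ), e.1⁻¹ * e'.1 ∉ wordBall S (r * n) → |q e'| ≤ ρ ^ n := by
  obtain ⟨ε, hε, hlow⟩ := hgap.exists_lower_bound
  obtain ⟨a, ρ, hρ0, hρ1, hρ⟩ := exists_richardson_contraction (d₁ o) (coexactSpace S) hε hlow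
  rw [adjoint_d₁] at hρ
  obtain ⟨r, hr⟩ := exists_propagation o hS
  have : CompleteSpace (coexactSpace S) :=
    (Submodule.isClosed_topologicalClosure _).completeSpace_coe
  refine ⟨ρ, r, hρ0, hρ1, fun e => ?_⟩
  set δ : L2 (Γ × S) := lp.single 2 e (1 : ℝ) with hδ
  have hδ1 : ‖δ‖ = 1 := by
    rw [hδ, lp.norm_single (by norm_num)]
    simp
  obtain ⟨p, hp, q, hq, hpq⟩ := (coexactSpace S).exists_add_mem_mem_orthogonal δ
  have hnorm : ‖δ‖ ^ 2 = ‖p‖ ^ 2 + ‖q‖ ^ 2 := by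
    rw [hpq, sq, sq, sq]
    exact norm_add_sq_eq_norm_sq_add_norm_sq_real (Submodule.inner_right_of_mem_orthogonal hp hq)
  rw [hδ1, one_pow] at hnorm
  have hdq := d₁_eq_zero_of_mem_orthogonal o hq
  refine ⟨q, hdq, ?_, ?_, fun e' n he' => ?_⟩
  · rw [hpq, add_sub_cancel_right]
    exact bd₁_eq_zero_of_mem_coexactSpace hp
  · nlinarith [sq_nonneg ‖p‖]
  -- `R` fixes the cocycle `q` and contracts `p`. Where the iterate of `δ` vanishes by finite
  -- propagation, `q` is minus the iterate of `p`, which is small.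
  · let R : L2 (Γ × S) → L2 (Γ × S) := fun f => f - a • bd₂ o (d₁ o f)
    have hRp : ∀ n, R^[n] p ∈ coexactSpace S ∧ ‖R^[n] p‖ ≤ ρ ^ n ∧ R^[n] δ = R^[n] p + q := by
      intro n
      induction n with
      | zero => exact ⟨hp, by simp; nlinarith [sq_nonneg ‖q‖], hpq⟩
      | succ n ih =>
        obtain ⟨h1, h2, h3⟩ := ih
        simp only [Function.iterate_succ_apply']
        refine ⟨Submodule.sub_mem _ h1 (Submodule.smul_mem _ _ (bd₂_d₁_mem_coexactSpace o h1)),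
          (hρ _ h1).trans ?_, ?_⟩
        · rw [pow_succ']
          gcongr
        · rw [h3]
          simp only [R, map_add, hdq, add_zero]
          abel
    have hsupp : ∀ n, ∀ e', R^[n] δ e' ≠ 0 → e.1⁻¹ * e'.1 ∈ wordBall S (r * n) := by
      intro n
      induction n with
      | zero =>
        intro e' he'
        have : e' = e := by
          by_contra hne
          exact he' (lp.single_apply_ne _ _ _ hne)
        rw [this, inv_mul_cancel]
        exact one_mem_wordBall _
      | succ n ih =>
        intro e' he'
        rw [Function.iterate_succ_apply'] at he'
        by_cases h1 : R^[n] δ e' = 0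
        · refine hr e.1 _ _ ih e' fun h2 => he' ?_
          change R^[n] δ e' - a * bd₂ o (d₁ o (R^[n] δ)) e' = 0
          rw [h1, h2, mul_zero, sub_zero]
        · exact wordBall_mono (Nat.mul_le_mul_left _ n.le_succ) (ih e' h1)
    obtain ⟨-, h2, h3⟩ := hRp n
    have h4 : R^[n] δ e' = 0 := by
      by_contra hne
      exact he' (hsupp n e' hne)
    rw [h3] at h4
    have h5 : q e' = -(R^[n] p) e' := by
      change (R^[n] p) e' + q e' = 0 at h4
      linarith
    rw [h5, abs_neg]
    exact (abs_apply_le_norm _ _).trans h2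

/-- The projection to the cocycles of the delta function of an edge decays exponentially in the
word metric. -/
theorem exists_exponentially_decaying_projection [DecidableEq (Γ × S)]
    (hS : Subgroup.closure (S : Set Γ) = ⊤)
    {o : (cayley S).FaceOrientation D} (hgap : HasCoexactSpectralGap o) :
    ∃ C κ : ℝ, 0 < C ∧ 0 < κ ∧ κ < 1 ∧ ∀ e : Γ × S, ∃ q : L2 (Γ × S), d₁ o q = 0 ∧
      bd₁ S (lp.single 2 e (1 : ℝ) - q) = 0 ∧
      ∀ e' : Γ × S, |q e'| ≤ C * (κ ^ 4) ^ wordLength S (e.1⁻¹ * e'.1) := by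
  obtain ⟨ρ, r, hρ0, hρ1, hproj⟩ := exists_decaying_projection hS hgap
  -- For `κ = c⁻¹` this says `κ ^ (4 * (r + 1)) = ρ`. Of the four powers of `κ`, two will make the
  -- increments summable and two will give the decay of the potential. With `r + 1` in place of `r`,
  -- the radius `r * (L / (r + 1))` is strictly below `L` when `L > 0`.
  obtain ⟨c, hc1, hc⟩ := exists_root_of_one_lt ((one_lt_inv₀ hρ0).2 hρ1) (R := 4 * (r + 1))
    (by omega)
  have hκ : (c⁻¹ ^ 4) ^ (r + 1) = ρ := by
    rw [← pow_mul, inv_pow, hc, inv_inv]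
  have hκ1 : c⁻¹ < 1 := inv_lt_one_of_one_lt₀ hc1
  have hκ0 : 0 < c⁻¹ := by positivity
  refine ⟨ρ⁻¹, c⁻¹, by positivity, hκ0, hκ1, fun e => ?_⟩
  obtain ⟨q, h1, h2, h3, h4⟩ := hproj e
  refine ⟨q, h1, h2, fun e' => ?_⟩
  set L := wordLength S (e.1⁻¹ * e'.1) with hL
  have key : |q e'| ≤ ρ ^ (L / (r + 1)) := by
    rcases Nat.eq_zero_or_pos L with h0 | h0
    · rw [h0, Nat.zero_div, pow_zero]
      exact (abs_apply_le_norm _ _).trans h3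
    · apply h4
      rw [← wordLength_le_iff hS, ← hL, not_le]
      have := Nat.div_mul_le_self L (r + 1)
      rcases Nat.eq_zero_or_pos (L / (r + 1)) with h | h
      · rw [h, mul_zero]; exact h0
      · nlinarith
  refine key.trans ?_
  -- The factor `ρ⁻¹` pays for rounding down `L / (r + 1)`.
  rw [← div_eq_inv_mul, le_div_iff₀ hρ0, ← pow_succ, ← hκ, ← pow_mul]
  refine pow_le_pow_of_le_one (by positivity) (pow_le_one₀ hκ0.le hκ1.le) ?_
  have := Nat.lt_div_mul_add (a := L) (Nat.succ_pos r)
  rw [mul_add, mul_one, mul_comm]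
  exact this.le

end Projection

end CoexactGap

namespace CoexactGap

open ContinuousLinearMap MeasureTheory Filter Topology
open scoped RealInnerProductSpace

/-! ### Decay of potentials -/

section Potential

variable {Γ : Type*} [Group Γ] {S : Finset Γ}

theorem countable_of_closure_eq_top (hS : Subgroup.closure (S : Set Γ) = ⊤) : Countable Γ := by
  rw [← Set.countable_univ_iff]
  refine (Set.countable_iUnion fun n => (finite_wordBall (S := S) n).countable).mono fun g _ => ?_
  exact Set.mem_iUnion.2 (exists_mem_wordBall hS g)

/-- If all sets with finite coboundary are finite or cofinite, then the oscillation of a function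
far away is bounded by the sum of its increments over far edges. -/
theorem abs_sub_le_tsum_of_isCutBy (hS : Subgroup.closure (S : Set Γ) = ⊤) {K L : Set Γ}
    (hends : ∀ A : Set Γ, IsCutBy S A K → A.Finite ∨ Aᶜ.Finite)
    (hKL : ∀ A : Set Γ, IsCutBy S A K → A.Finite → A ⊆ L) (v : Γ → ℝ) {b : Γ × S → ℝ}
    (hb0 : ∀ e, 0 ≤ b e) (hb : Summable b)
    (hvb : ∀ (g : Γ) (s : S), ¬ (g ∈ K ∧ g * s ∈ K) → |v (g * s) - v g| ≤ b (g, s)) {x y : Γ}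
    (hx : x ∉ L) (hy : y ∉ L) : |v x - v y| ≤ ∑' e, b e := by
  wlog hxy : v x ≤ v y generalizing x y
  · rw [abs_sub_comm]
    exact this hy hx (le_of_not_ge hxy)
  have := countable_of_closure_eq_top hS
  -- Coarea argument: for `t` in the interval, `{v > t}` contains `y` but not `x`. Were all its
  -- boundary edges inside `K`, it or its complement would be finite, putting `y` or `x` into `L`.
  -- So an edge outside `K` crosses the level `t`, and the lengths of these jumps cover the
  -- interval.
  have hcover : Set.Ioo (v x) (v y) ⊆ ⋃ e : Γ × S,
      {t | ¬ (e.1 ∈ K ∧ e.1 * e.2 ∈ K) ∧ t ∈ Set.uIcc (v e.1) (v (e.1 * e.2))} := by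
    intro t ht
    by_contra hn
    simp only [Set.mem_iUnion, Set.mem_ofPred_eq, not_exists, Prod.forall] at hn
    have hcut : IsCutBy S {g | t < v g} K := by
      intro g s hs hg
      by_contra hK
      refine hn g ⟨s, hs⟩ ⟨hK, ?_⟩
      simp only [Set.mem_ofPred_eq] at hg
      rw [Set.mem_uIcc]
      by_cases h1 : t < v g
      · right
        have : ¬ t < v (g * s) := fun h2 => hg (iff_of_true h1 h2)
        exact ⟨not_lt.1 this, h1.le⟩
      · left
        have : t < v (g * s) := by
          by_contra h2
          exact hg (iff_of_false h1 h2)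
        exact ⟨not_lt.1 h1, this.le⟩
    rcases hends _ hcut with h | h
    · exact hy (hKL _ hcut h ht.2)
    · exact hx (hKL _ hcut.compl h (not_lt.2 ht.1.le))
  have hvol : ∀ e : Γ × S,
      volume {t | ¬ (e.1 ∈ K ∧ e.1 * e.2 ∈ K) ∧ t ∈ Set.uIcc (v e.1) (v (e.1 * e.2))} ≤
        ENNReal.ofReal (b e) := by
    rintro ⟨g, s⟩
    by_cases hK : g ∈ K ∧ g * s ∈ K
    · simp [hK]
    · simp only [hK, not_false_eq_true, true_and]
      change volume (Set.uIcc (v g) (v (g * s))) ≤ _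
      rw [Real.volume_interval]
      exact ENNReal.ofReal_le_ofReal (hvb g s hK)
  have h := (measure_mono hcover).trans ((measure_iUnion_le _).trans (ENNReal.tsum_le_tsum hvol))
  rw [Real.volume_Ioo, ← ENNReal.ofReal_tsum_of_nonneg hb0 hb,
    ENNReal.ofReal_le_ofReal_iff (tsum_nonneg hb0)] at h
  rw [abs_sub_comm, abs_of_nonneg (by linarith)]
  exact h

/-- A function with exponentially decaying increments converges exponentially fast to a constant,
if all sets with finite coboundary are finite or cofinite. -/
theorem exists_const_abs_sub_le [Infinite Γ] (hS : Subgroup.closure (S : Set Γ) = ⊤)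
    (hg : ¬ HasExponentialGrowth S)
    (hends : ∀ A K : Set Γ, K.Finite → IsCutBy S A K → A.Finite ∨ Aᶜ.Finite) {C κ : ℝ}
    (hC : 0 < C) (hκ0 : 0 < κ) (hκ1 : κ < 1) :
    ∃ C' : ℝ, 0 < C' ∧ ∀ v : Γ → ℝ,
      (∀ (g : Γ) (s : S), |v (g * s) - v g| ≤ C * (κ ^ 4) ^ wordLength S g) →
      ∃ c : ℝ, ∀ x, |v x - c| ≤ C' * κ ^ wordLength S x := by
  have hτ1 : κ ^ 2 < 1 := pow_lt_one₀ hκ0.le hκ1 two_ne_zero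
  have hsum : Summable fun e : Γ × S => C * (κ ^ 2) ^ wordLength S e.1 := by
    have h := (summable_pow_wordLength hS hg (pow_pos hκ0 2) hτ1).mul_of_nonneg
      (Summable.of_finite (f := fun _ : S => (1 : ℝ))) (fun _ => by positivity)
      (fun _ => by positivity)
    simpa using h.mul_left C
  set A : ℝ := ∑' e : Γ × S, C * (κ ^ 2) ^ wordLength S e.1 with hA
  have hA0 : 0 ≤ A := tsum_nonneg fun e => by positivity
  refine ⟨(A + 1) * (κ ^ 2)⁻¹, by positivity, fun v hv => ?_⟩
  have hosc0 : ∀ x y, |v x - v y| ≤ A := by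
    intro x y
    refine abs_sub_le_tsum_of_isCutBy hS (K := ∅) (L := ∅) (fun B => hends B ∅ Set.finite_empty)
      (fun B hB hfin => ?_) v (fun e => by positivity) hsum (fun g s _ => (hv g s).trans ?_)
      (Set.notMem_empty x) (Set.notMem_empty y)
    · by_contra hne
      rw [Set.subset_empty_iff] at hne
      have := IsCutBy.eq_univ hS hB (Set.nonempty_iff_ne_empty.2 hne)
      exact Set.infinite_univ (this ▸ hfin)
    · have : κ ^ 4 ≤ κ ^ 2 := pow_le_pow_of_le_one hκ0.le hκ1.le (by norm_num)
      gcongr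
  -- A finite set cut inside `B(m)` lies in `B(2m)`, so only edges outside `B(m)` count. Splitting
  -- `κ ^ 4` into two squares, one gives `(κ ^ 2) ^ m` and the other is summed.
  have hosc : ∀ (m : ℕ) (x y : Γ), x ∉ wordBall S (2 * m) → y ∉ wordBall S (2 * m) →
      |v x - v y| ≤ A * (κ ^ 2) ^ m := by
    intro m x y hx hy
    rw [mul_comm, hA, ← tsum_mul_left]
    refine abs_sub_le_tsum_of_isCutBy hS (fun B => hends B _ (finite_wordBall (S := S) m))
      (fun B hB hfin => hB.subset_wordBall_of_finite hS hfin) v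
      (fun e => by positivity) (hsum.mul_left _) (fun g s hgs => (hv g s).trans ?_) hx hy
    have hm : m ≤ wordLength S g := by
      by_contra! hlt
      apply hgs
      obtain ⟨k, rfl⟩ := Nat.exists_eq_succ_of_ne_zero (n := m) (by omega)
      have h1 : g ∈ wordBall S k := (wordLength_le_iff hS).1 (by omega)
      exact ⟨wordBall_mono k.le_succ h1, mul_mem_wordBall h1 (mem_wordBall_one s.2)⟩
    calc C * (κ ^ 4) ^ wordLength S g
        = (κ ^ 2) ^ wordLength S g * (C * (κ ^ 2) ^ wordLength S g) := by ring
      _ ≤ (κ ^ 2) ^ m * (C * (κ ^ 2) ^ wordLength S g) := by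
          have := pow_le_pow_of_le_one (pow_pos hκ0 2).le hτ1.le hm
          gcongr
  have hfar : ∀ m : ℕ, ∃ x, x ∉ wordBall S (2 * m) := fun m =>
    (finite_wordBall (S := S) (2 * m)).infinite_compl.nonempty
  choose z hz using hfar
  have hzm : ∀ {m n : ℕ}, m ≤ n → z n ∉ wordBall S (2 * m) := fun hmn h =>
    hz _ (wordBall_mono (Nat.mul_le_mul_left 2 hmn) h)
  have hcauchy : CauchySeq fun n => v (z n) := by
    refine cauchySeq_of_le_geometric (κ ^ 2) A hτ1 fun n => ?_
    rw [Real.dist_eq]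
    exact hosc n _ _ (hz n) (hzm n.le_succ)
  obtain ⟨c, hc⟩ := cauchySeq_tendsto_of_complete hcauchy
  refine ⟨c, fun x => ?_⟩
  have hlim : Tendsto (fun n => |v x - v (z n)|) atTop (𝓝 |v x - c|) :=
    (hc.const_sub (v x)).abs
  have hAA : A ≤ A + 1 := by linarith
  rcases Nat.eq_zero_or_pos (wordLength S x) with h0 | h0
  · rw [h0, pow_zero, mul_one]
    refine le_of_tendsto' hlim fun n => (hosc0 _ _).trans ?_
    have : 1 ≤ (κ ^ 2)⁻¹ := (one_le_inv₀ (pow_pos hκ0 2)).2 hτ1.le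
    nlinarith
  -- The largest `m` with `2 * m < wordLength S x`; as `2 * m + 2 ≥ wordLength S x`, the loss is a
  -- factor `(κ ^ 2)⁻¹`.
  · set m := (wordLength S x - 1) / 2 with hm
    have hx : x ∉ wordBall S (2 * m) := by
      rw [← wordLength_le_iff hS]
      omega
    refine le_of_tendsto hlim ((eventually_ge_atTop m).mono fun n hn =>
      (hosc m _ _ hx (hzm hn)).trans ?_)
    have h1 : κ ^ (2 * m + 2) ≤ κ ^ wordLength S x :=
      pow_le_pow_of_le_one hκ0.le hκ1.le (by omega)
    calc A * (κ ^ 2) ^ m = A * (κ ^ 2)⁻¹ * κ ^ (2 * m + 2) := by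
          rw [pow_add, pow_mul]
          field_simp
      _ ≤ (A + 1) * (κ ^ 2)⁻¹ * κ ^ wordLength S x := by gcongr

end Potential

/-! ### A Schur test -/

section Schur

theorem inner_eq_tsum_mul {I : Type*} (f g : L2 I) : ⟪f, g⟫ = ∑' i, f i * g i := by
  rw [lp.inner_eq_tsum]
  simp [mul_comm]

theorem summable_mul {I : Type*} (f g : L2 I) : Summable fun i => f i * g i := by
  have := lp.summable_inner (𝕜 := ℝ) f g
  simpa [mul_comm] using this

theorem norm_sq_eq_tsum {I : Type*} (f : L2 I) : ‖f‖ ^ 2 = ∑' i, f i ^ 2 := by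
  rw [← real_inner_self_eq_norm_sq, inner_eq_tsum_mul]
  simp only [sq]

theorem summable_sq {I : Type*} (f : L2 I) : Summable fun i => f i ^ 2 := by
  simpa only [sq] using summable_mul f f

/-- Weighted Cauchy–Schwarz: sum `2 t f η ≤ W (t ^ 2 + η ^ 2)` and optimize over `t`. -/
theorem sq_inner_le_tsum_mul {I : Type*} {W : I → ℝ} (hW : Summable W) (f η : L2 I)
    (hf : ∀ i, |f i| ≤ W i) :
    Summable (fun i => W i * η i ^ 2) ∧ ⟪f, η⟫ ^ 2 ≤ (∑' i, W i) * ∑' i, W i * η i ^ 2 := by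
  have hW0 : ∀ i, 0 ≤ W i := fun i => (abs_nonneg _).trans (hf i)
  have hs : Summable fun i => W i * η i ^ 2 := by
    refine Summable.of_nonneg_of_le (fun i => by have := hW0 i; positivity) (fun i => ?_)
      (hW.mul_right (‖η‖ ^ 2))
    refine mul_le_mul_of_nonneg_left ?_ (hW0 i)
    exact sq_le_sq' (neg_le_of_abs_le (abs_apply_le_norm η i)) (le_of_abs_le (abs_apply_le_norm η i))
  refine ⟨hs, ?_⟩
  set y := ⟪f, η⟫ with hy
  set w := ∑' i, W i
  have key : ∀ t : ℝ, 2 * t * y ≤ t ^ 2 * w + ∑' i, W i * η i ^ 2 := by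
    intro t
    rw [hy, inner_eq_tsum_mul, ← tsum_mul_left, ← tsum_mul_left, ← (hW.mul_left _).tsum_add hs]
    refine Summable.tsum_le_tsum (fun i => ?_) ((summable_mul f η).mul_left _)
      ((hW.mul_left _).add hs)
    have h2 : 2 * t * (f i * η i) ≤ |f i| * (t ^ 2 + η i ^ 2) := by
      rcases abs_cases (f i) with ⟨h, h'⟩ | ⟨h, h'⟩ <;> rw [h]
      · nlinarith [mul_nonneg h' (sq_nonneg (t - η i))]
      · nlinarith [mul_nonneg (neg_nonneg.2 h'.le) (sq_nonneg (t + η i))]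
    have h3 : |f i| * (t ^ 2 + η i ^ 2) ≤ W i * (t ^ 2 + η i ^ 2) :=
      mul_le_mul_of_nonneg_right (hf i) (by positivity)
    linarith
  have hw0 : 0 ≤ w := tsum_nonneg hW0
  have hb0 : 0 ≤ ∑' i, W i * η i ^ 2 := tsum_nonneg fun i => mul_nonneg (hW0 i) (sq_nonneg _)
  rcases hw0.eq_or_lt with h | h
  · rw [← h, zero_mul]
    by_contra! hy0
    have hy0 : y ≠ 0 := fun h0 => by simp [h0] at hy0
    -- For `w = 0` the bound is linear in `t` on one side only; this `t` violates it unless `y = 0`.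
    have h1 := key ((∑' i, W i * η i ^ 2 + 1) / y)
    rw [← h, mul_zero, zero_add, mul_assoc, div_mul_cancel₀ _ hy0] at h1
    linarith
  · have h1 := key (y / w)
    have e1 : 2 * (y / w) * y = 2 * (y ^ 2 / w) := by ring
    have e2 : (y / w) ^ 2 * w = y ^ 2 / w := by field_simp
    rw [e1, e2] at h1
    have h2 : y ^ 2 / w ≤ ∑' i, W i * η i ^ 2 := by linarith
    rw [div_le_iff₀ h] at h2
    linarith

variable {Γ : Type*} [Group Γ] {S : Finset Γ}

/-- Schur test for kernels dominated by a summable function of `g⁻¹ x`. -/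
theorem norm_le_of_kernel {W : Γ → ℝ} (hW0 : ∀ x, 0 ≤ W x) (hW : Summable W) (φ : L2 (Γ × S))
    (η : L2 Γ) (h : ∀ e : Γ × S, ∃ f : L2 Γ, (∀ x, |f x| ≤ W (e.1⁻¹ * x)) ∧ φ e = ⟪f, η⟫) :
    ‖φ‖ ≤ (S.card + 1) * (∑' x, W x) * ‖η‖ := by
  classical
  set w := ∑' x, W x with hw
  have hw0 : 0 ≤ w := tsum_nonneg hW0
  have hWl : ∀ g : Γ, Summable (fun x => W (g * x)) ∧ ∑' x, W (g * x) = w := fun g =>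
    ⟨(Equiv.mulLeft g).summable_iff.2 hW, (Equiv.mulLeft g).tsum_eq W⟩
  have hWr : ∀ x : Γ, Summable (fun g => W (g⁻¹ * x)) ∧ ∑' g, W (g⁻¹ * x) = w := fun x =>
    ⟨((Equiv.inv Γ).trans (Equiv.mulRight x)).summable_iff.2 hW,
      ((Equiv.inv Γ).trans (Equiv.mulRight x)).tsum_eq W⟩
  have hrow : ∀ e : Γ × S, Summable (fun x => W (e.1⁻¹ * x) * η x ^ 2) ∧
      φ e ^ 2 ≤ w * ∑' x, W (e.1⁻¹ * x) * η x ^ 2 := by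
    intro e
    obtain ⟨f, hf, hfe⟩ := h e
    have := sq_inner_le_tsum_mul (hWl e.1⁻¹).1 f η hf
    rw [(hWl e.1⁻¹).2, ← hfe] at this
    exact this
  -- Each group element begins at most `S.card` edges of `F`.
  have hcol : ∀ (F : Finset (Γ × S)) (x : Γ), ∑ e ∈ F, W (e.1⁻¹ * x) ≤ S.card * w := by
    intro F x
    calc ∑ e ∈ F, W (e.1⁻¹ * x)
        ≤ ∑ e ∈ F.image Prod.fst ×ˢ (Finset.univ : Finset S), W (e.1⁻¹ * x) := by
          refine Finset.sum_le_sum_of_subset_of_nonneg (fun e he => ?_) fun e _ _ => hW0 _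
          simp only [Finset.mem_product, Finset.mem_univ, and_true]
          exact Finset.mem_image_of_mem _ he
      _ = S.card * ∑ g ∈ F.image Prod.fst, W (g⁻¹ * x) := by
          rw [Finset.sum_product, Finset.mul_sum]
          simp
      _ ≤ S.card * w := by
          gcongr
          rw [← (hWr x).2]
          exact (hWr x).1.sum_le_tsum _ fun g _ => hW0 _
  refine le_of_sq_le_sq ?_ (by positivity)
  rw [norm_sq_eq_tsum]
  refine (summable_sq φ).tsum_le_of_sum_le fun F => ?_
  calc ∑ e ∈ F, φ e ^ 2 ≤ ∑ e ∈ F, w * ∑' x, W (e.1⁻¹ * x) * η x ^ 2 :=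
        Finset.sum_le_sum fun e _ => (hrow e).2
    _ = w * ∑' x, (∑ e ∈ F, W (e.1⁻¹ * x)) * η x ^ 2 := by
        rw [← Finset.mul_sum, ← Summable.tsum_finsetSum fun e _ => (hrow e).1]
        simp_rw [Finset.sum_mul]
    _ ≤ w * ∑' x, S.card * w * η x ^ 2 := by
        refine mul_le_mul_of_nonneg_left (Summable.tsum_le_tsum (fun x => ?_) ?_
          ((summable_sq η).mul_left _)) hw0
        · exact mul_le_mul_of_nonneg_right (hcol F x) (sq_nonneg _)
        · simp_rw [Finset.sum_mul]
          exact summable_sum fun e _ => (hrow e).1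
    _ = S.card * (w * ‖η‖) ^ 2 := by
        rw [tsum_mul_left, ← norm_sq_eq_tsum]
        ring
    _ ≤ (S.card + 1) ^ 2 * (w * ‖η‖) ^ 2 := by
        gcongr
        nlinarith [(Nat.cast_nonneg S.card : (0 : ℝ) ≤ S.card)]
    _ = ((S.card + 1) * w * ‖η‖) ^ 2 := by ring

end Schur

end CoexactGap

namespace CoexactGap

open ContinuousLinearMap Filter Topology
open scoped RealInnerProductSpace

/-! ### Isoperimetry and growth -/

section Coercive

variable {H F : Type*} [NormedAddCommGroup H] [InnerProductSpace ℝ H] [CompleteSpace H]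
  [NormedAddCommGroup F] [InnerProductSpace ℝ F] [CompleteSpace F]

/-- If `d` is injective and `d*` is bounded below on the image of `d`, then `d` is bounded
below. -/
theorem norm_le_of_adjoint_bounded_below (d : H →L[ℝ] F) (hinj : ∀ f, d f = 0 → f = 0) {C : ℝ}
    (hC : ∀ f, ‖d f‖ ≤ C * ‖adjoint d (d f)‖) (hC0 : 0 ≤ C) (f : H) : ‖f‖ ≤ 3 * C * ‖d f‖ := by
  -- `d* d` is self-adjoint and, by `hC` and `hinj`, injective, so its range is dense.
  have hdense : (adjoint d ∘L d).range.topologicalClosure = ⊤ := by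
    rw [Submodule.topologicalClosure_eq_top_iff, orthogonal_range, adjoint_comp, adjoint_adjoint,
      Submodule.eq_bot_iff]
    intro g hg
    apply hinj
    have h0 : adjoint d (d g) = 0 := hg
    have := hC g
    rwa [h0, norm_zero, mul_zero, norm_le_zero_iff] at this
  rcases eq_or_ne f 0 with rfl | hf
  · simp
  have hf0 : 0 < ‖f‖ := norm_pos_iff.2 hf
  have hmem : f ∈ closure (Set.range (adjoint d ∘L d)) := by
    have : f ∈ (adjoint d ∘L d).range.topologicalClosure := hdense ▸ Submodule.mem_top
    exact this
  obtain ⟨_, ⟨g, rfl⟩, hg⟩ := Metric.mem_closure_iff.1 hmem (‖f‖ / 2) (by linarith)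
  rw [dist_eq_norm, comp_apply] at hg
  set T := adjoint d (d g) with hT
  -- Pairing `f` with the nearby `T = d* d g` moves one `d` onto `f`; the error is at most half of
  -- `‖f‖ ^ 2`, and `‖T‖ ≤ 3 / 2 * ‖f‖` produces the constant `3`.
  have h1 : ‖f‖ ^ 2 = ⟪d f, d g⟫ + ⟪f, f - T⟫ := by
    rw [inner_sub_right, hT, adjoint_inner_right, real_inner_self_eq_norm_sq]
    ring
  have h2 := real_inner_le_norm (d f) (d g)
  have h3 := real_inner_le_norm f (f - T)
  have h4 : ‖T‖ ≤ 3 / 2 * ‖f‖ := by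
    have := norm_sub_norm_le T f
    rw [norm_sub_rev] at this
    linarith
  have h5 : ‖d f‖ * ‖d g‖ ≤ ‖d f‖ * (C * (3 / 2 * ‖f‖)) := by
    refine mul_le_mul_of_nonneg_left ((hC g).trans ?_) (norm_nonneg _)
    gcongr
  have h6 : ‖f‖ * ‖f - T‖ ≤ ‖f‖ * (‖f‖ / 2) := by gcongr
  have h7 : ‖f‖ * ‖f‖ ≤ (3 * C * ‖d f‖) * ‖f‖ := by nlinarith
  exact le_of_mul_le_mul_right h7 hf0

end Coercive

/-! ### Coboundaries of functions, isoperimetry and the main estimate. -/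

section Final

variable {Γ : Type*} [Group Γ] {S : Finset Γ}

theorem incMap_inc₁ (f : Γ → ℝ) (g : Γ) (s : S) :
    incMap (cayley S).inc₁ f (g, s) = f (g * s) - f g := by
  classical
  have hinc : ∀ v, (cayley S).inc₁ (g, s) v =
      (if g * s = v then 1 else 0) - (if g = v then 1 else 0) := by
    intro v
    unfold OrientedGraph.inc₁
    congr
  rw [incMap_eq_sum (cayley S).inc₁ f (g, s) {g * (s : Γ), g}]
  · simp [hinc, sub_mul, Finset.sum_sub_distrib]
  · intro v hv
    by_contra hn
    simp only [Finset.mem_insert, Finset.mem_singleton, not_or] at hn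
    exact hv (by rw [hinc, if_neg (Ne.symm hn.1), if_neg (Ne.symm hn.2), sub_zero])

theorem d₀_apply (f : L2 Γ) (g : Γ) (s : S) : d₀ S f (g, s) = f (g * s) - f g :=
  incMap_inc₁ f g s

/-- Such an `f` is constant by connectedness, and a nonzero constant is not square summable on an
infinite group. -/
theorem eq_zero_of_d₀_eq_zero [Infinite Γ] (hS : Subgroup.closure (S : Set Γ) = ⊤) {f : L2 Γ}
    (hf : d₀ S f = 0) : f = 0 := by
  have hcut : IsCutBy S {x | f x = f 1} ∅ := by
    intro g s hs hg
    have h := d₀_apply (S := S) f g ⟨s, hs⟩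
    rw [hf] at h
    have h' : f (g * s) = f g := (sub_eq_zero.1 h.symm)
    exact absurd (by simp [h']) hg
  have huniv := IsCutBy.eq_univ hS hcut ⟨1, rfl⟩
  have hconst : ∀ x, f x = f 1 := fun x => (huniv ▸ Set.mem_univ x : x ∈ {x | f x = f 1})
  have hsum := summable_sq f
  simp_rw [hconst] at hsum
  have h1 : f 1 = 0 := pow_eq_zero_iff two_ne_zero |>.1 ((summable_const_iff _).1 hsum)
  ext x
  rw [hconst, h1]
  rfl

theorem memℓp_two_of_summable {I : Type*} {f : I → ℝ} (hf : Summable fun i => |f i|) :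
    Memℓp f 2 := by
  have h1 : Memℓp f 1 := memℓp_gen (by simpa using hf)
  exact h1.of_exponent_ge (by norm_num)

/-- A lower bound for `d` on `ℓ²(V)` implies exponential growth. -/
theorem hasExponentialGrowth_of_lower_bound {C : ℝ}
    (h : ∀ f : L2 Γ, ‖f‖ ≤ C * ‖d₀ S f‖) : HasExponentialGrowth S := by
  classical
  set b : ℕ → ℝ := fun n => ((wordBall S n).ncard : ℝ) with hb
  set N : ℝ := C ^ 2 * (2 * S.card) + 1 with hN
  have hN0 : 0 < N := by positivity
  have hmono : ∀ n, b n ≤ b (n + 1) := fun n => by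
    simp only [hb]
    exact_mod_cast Set.ncard_le_ncard (wordBall_mono n.le_succ) (finite_wordBall (n + 1))
  -- Test the bound on the indicator of the ball: its coboundary is at most `1` in absolute value
  -- and lives on edges touching the sphere of radius `n + 1`, at most `2 * S.card` per vertex.
  have key : ∀ n, b n ≤ N * (b (n + 1) - b n) := by
    intro n
    set B := (finite_wordBall (S := S) n).toFinset with hB
    set B' := (finite_wordBall (S := S) (n + 1)).toFinset with hB'
    have hBB' : B ⊆ B' := by
      intro x hx
      simp only [hB, hB', Set.Finite.mem_toFinset] at hx ⊢
      exact wordBall_mono n.le_succ hx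
    have hnb : b n = B.card := by
      simp only [hb]; rw [Set.ncard_eq_toFinset_card _ (finite_wordBall n)]
    have hnb' : b (n + 1) = B'.card := by
      simp only [hb]; rw [Set.ncard_eq_toFinset_card _ (finite_wordBall (n + 1))]
    let χ : Γ → ℝ := fun x => if x ∈ B then 1 else 0
    have hχ : Memℓp χ 2 := memℓp_two_of_summable
      (summable_of_ne_finset_zero (s := B) fun x hx => by simp [χ, hx])
    let f : L2 Γ := ⟨χ, hχ⟩
    have hfχ : ∀ x, f x = if x ∈ B then 1 else 0 := fun x => rfl
    have hnorm : ‖f‖ ^ 2 = B.card := by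
      rw [norm_sq_eq_tsum, tsum_eq_sum (s := B)]
      · rw [Finset.sum_congr rfl (g := fun _ => (1 : ℝ))]
        · simp
        · intro x hx
          simp [hfχ, hx]
      · intro x hx
        simp [hfχ, hx]
    let bB : Finset Γ := B' \ B
    let E₁ : Finset (Γ × S) := bB ×ˢ Finset.univ
    let E₂ : Finset (Γ × S) := (bB ×ˢ (Finset.univ : Finset S)).image
      fun p => (p.1 * (p.2 : Γ)⁻¹, p.2)
    have hsupp : ∀ e ∉ E₁ ∪ E₂, d₀ S f e = 0 := by
      rintro ⟨g, s⟩ he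
      rw [d₀_apply, hfχ, hfχ]
      have h1 : g ∈ B → g * s ∈ B' := by
        simp only [hB, hB', Set.Finite.mem_toFinset]
        exact fun hg => mul_mem_wordBall hg (mem_wordBall_one s.2)
      have h2 : g * s ∈ B → g ∈ B' := by
        simp only [hB, hB', Set.Finite.mem_toFinset]
        intro hg
        simpa using mul_mem_wordBall hg (inv_mem_wordBall (mem_wordBall_one s.2))
      have h3 : g ∉ bB := by
        intro hg
        exact he (Finset.mem_union_left _ (by simp [E₁, hg]))
      have h4 : g * s ∉ bB := by
        intro hg
        refine he (Finset.mem_union_right _ (Finset.mem_image.2 ⟨(g * s, s), by simp [hg], by simp⟩))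
      simp only [bB, Finset.mem_sdiff, not_and, not_not] at h3 h4
      by_cases hg : g ∈ B <;> by_cases hgs : g * s ∈ B <;> simp [hg, hgs] <;> tauto
    have hcard : (E₁ ∪ E₂).card ≤ 2 * S.card * bB.card := by
      refine (Finset.card_union_le _ _).trans ?_
      have h1 : E₁.card = bB.card * S.card := by simp [E₁]
      have h2 : E₂.card ≤ bB.card * S.card := Finset.card_image_le.trans (by simp)
      nlinarith
    have hdnorm : ‖d₀ S f‖ ^ 2 ≤ 2 * S.card * bB.card := by
      rw [norm_sq_eq_tsum, tsum_eq_sum (s := E₁ ∪ E₂)]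
      · refine (Finset.sum_le_card_nsmul _ _ 1 fun e _ => ?_).trans ?_
        · obtain ⟨g, s⟩ := e
          rw [d₀_apply, hfχ, hfχ]
          split_ifs <;> norm_num
        · rw [nsmul_eq_mul, mul_one]
          exact_mod_cast hcard
      · intro e he
        rw [hsupp e he]
        norm_num
    have hcb : (bB.card : ℝ) = b (n + 1) - b n := by
      rw [hnb, hnb', Finset.card_sdiff_of_subset hBB', Nat.cast_sub (Finset.card_le_card hBB')]
    rw [← hcb, hnb, ← hnorm]
    calc ‖f‖ ^ 2 ≤ (C * ‖d₀ S f‖) ^ 2 := by gcongr; exact h f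
      _ = C ^ 2 * ‖d₀ S f‖ ^ 2 := by ring
      _ ≤ C ^ 2 * (2 * S.card * bB.card) := by gcongr
      _ ≤ N * bB.card := by
        rw [hN]
        have : (0 : ℝ) ≤ bB.card := by positivity
        nlinarith
  refine ⟨1 + N⁻¹, by simpa using hN0, fun n => ?_⟩
  induction n with
  | zero => simp [wordBall_zero]
  | succ n ih =>
    have h1 : N⁻¹ * b n ≤ b (n + 1) - b n := by
      rw [inv_mul_le_iff₀ hN0]
      exact key n
    calc (1 + N⁻¹) ^ (n + 1) = (1 + N⁻¹) * (1 + N⁻¹) ^ n := pow_succ' _ _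
      _ ≤ (1 + N⁻¹) * b n := by gcongr
      _ ≤ b (n + 1) := by linarith

/-- Functions on the group are recovered from their Laplacian with a loss which is exponentially
localized, if all sets with finite coboundary are finite or cofinite. -/
theorem exists_norm_d₀_le [Infinite Γ] {R : Set (List (S × Bool))} (hSR : IsPresentation S R)
    {D : ℕ} (hD : ∀ r ∈ R, r.length ≤ D) {o : (cayley S).FaceOrientation D}
    (hgap : HasCoexactSpectralGap o) (hg : ¬ HasExponentialGrowth S)
    (hends : ∀ A K : Set Γ, K.Finite → IsCutBy S A K → A.Finite ∨ Aᶜ.Finite) :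
    ∃ C : ℝ, 0 ≤ C ∧ ∀ f : L2 Γ, ‖d₀ S f‖ ≤ C * ‖bd₁ S (d₀ S f)‖ := by
  classical
  have hS := hSR.1
  obtain ⟨C, κ, hC, hκ0, hκ1, hproj⟩ := exists_exponentially_decaying_projection hS hgap
  obtain ⟨C', hC', hpot⟩ := exists_const_abs_sub_le hS hg hends hC hκ0 hκ1
  have hsum : Summable fun x : Γ => C' * κ ^ wordLength S x :=
    (summable_pow_wordLength hS hg hκ0 hκ1).mul_left C'
  have hnonneg : ∀ x : Γ, 0 ≤ C' * κ ^ wordLength S x := fun x => by positivity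
  refine ⟨(S.card + 1) * ∑' x : Γ, C' * κ ^ wordLength S x,
    mul_nonneg (by positivity) (tsum_nonneg hnonneg), fun f => ?_⟩
  refine norm_le_of_kernel hnonneg hsum _ _ fun e => ?_
  obtain ⟨q, hdq, hbq, hq⟩ := hproj e
  obtain ⟨u, hu⟩ := exists_potential hSR hD o hdq
  -- Translating `e.1` to the identity makes the decay constants independent of `e`.
  obtain ⟨c, hc⟩ := hpot (fun x => u (e.1 * x)) fun g s => by
    have := hq (e.1 * g, s)
    rwa [hu, inv_mul_cancel_left, mul_assoc] at this
  have hbound : ∀ x, |u x - c| ≤ C' * κ ^ wordLength S (e.1⁻¹ * x) := fun x => by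
    simpa using hc (e.1⁻¹ * x)
  have hmem : Memℓp (fun x => u x - c) 2 := by
    refine memℓp_two_of_summable (Summable.of_nonneg_of_le (fun x => abs_nonneg _) hbound ?_)
    exact (Equiv.mulLeft e.1⁻¹).summable_iff.2 hsum
  let U : L2 Γ := ⟨fun x => u x - c, hmem⟩
  have hdU : d₀ S U = q := by
    ext ⟨g, s⟩
    rw [d₀_apply, hu]
    exact sub_sub_sub_cancel_right _ _ _
  refine ⟨U, hbound, ?_⟩
  -- `(df)(e) = ⟨δ_e, df⟩ = ⟨q, df⟩ = ⟨U, ∂df⟩`; the middle equality holds since `∂(δ_e - q) = 0`.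
  rw [← inner_single_one, ← adjoint_d₀, adjoint_inner_right, hdU,
    ← sub_eq_zero, ← inner_sub_left, ← adjoint_inner_left, adjoint_d₀, hbq, inner_zero_left]

end Final

end CoexactGap

theorem theorem1 {Γ : Type*} [Group Γ] [Infinite Γ] (S : Finset Γ)
    (R : Set (List (S × Bool))) (hR : R.Finite) (hSR : CoexactGap.IsPresentation S R)
    (D : ℕ) (hD : ∀ r ∈ R, r.length ≤ D)
    (o : (CoexactGap.cayley S).FaceOrientation D)
    (hgap : CoexactGap.HasCoexactSpectralGap o) :
    CoexactGap.HasExponentialGrowth S ∨ CoexactGap.IsVirtuallyInfiniteCyclic Γ := by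
  by_contra hn
  rw [not_or] at hn
  obtain ⟨C, hC0, hC⟩ := CoexactGap.exists_norm_d₀_le hSR hD hgap hn.1 fun A K hK hA => by
    by_contra! hinf
    exact (not_or.2 hn) (hA.growth_or_virtually_cyclic hSR.1 hK hinf.1 hinf.2)
  refine hn.1 (CoexactGap.hasExponentialGrowth_of_lower_bound (C := 3 * C) ?_)
  refine CoexactGap.norm_le_of_adjoint_bounded_below _
    (fun f hf => CoexactGap.eq_zero_of_d₀_eq_zero hSR.1 hf) (fun f => ?_) hC0
  rw [CoexactGap.adjoint_d₀]
  exact hC f
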